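/- Let $\tau=(1+\sqrt5)/2$, let $$R_+=\{(2,0,0),(0,2,0),(0,0,2),(\tau,\pm\tau^{-1},\pm1),(\pm1,\tau,\pm\tau^{-1}),(\tau^{-1},\pm1,\tau),(-\tau^{-1},1,\tau),(\tau^{-1},1,-\tau)\}$$ (independent signs) be the $15$ positive roots of type $H_3$, and let $$\mathcal I=\{(0,\pm\tau,\pm1),(\pm1,0,\pm\tau),(\pm\tau,\pm1,0)\}$$ be the $12$ vertices of the regular icosahedron. Let $\mathbb F$ be an extension field of $\mathbb R$, let $\kappa\in\mathbb F$ and $\mathcal P=\mathbb F[x_1,x_2,x_3]$; write $\mathcal P_n\subset\mathcal P$ for the homogeneous polynomials of degree $n$ and $(a)_m=a(a+1)\cdots(a+m-1)$. For $v\in R_+$ let $x\sigma_v=x-2\frac{\langle x,v\rangle}{|v|^2}v$. The Dunkl operators on $\mathcal P$ are $$\mathcal D_i f(x)=\frac{\partial f}{\partial x_i}(x)+\kappa\sum_{v\in R_+}\frac{f(x)-f(x\sigma_v)}{\langle x,v\rangle}\,v_i ,\qquad i=1,2,3,$$ and $\nabla_\kappa=(\mathcal D_1,\mathcal D_2,\mathcal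 D_3)$. An intertwining operator is an $\mathbb F$-linear map $V:\mathcal P\to\mathcal P$ such that $V1=1$, $V\mathcal P_n\subset\mathcal P_n$ for all $n\ge0$, and $\langle u,\nabla_\kappa\rangle Vp=V(\langle u,\nabla\rangle p)$ for all $u\in\mathbb R^3$, $p\in\mathcal P$. For $y_0\in\mathcal I$ define polynomials $q_n(x;y_0)\in\mathcal P$ by the expansion in powers of $r$ (with the binomial series $(1-ra)^{-c}=\sum_{m\ge0}\frac{(c)_m}{m!}a^mr^m$) $$(1-r\langle x,y_0\rangle)^{-1}\prod_{y\in\mathcal I}(1-r\langle x,y\rangle)^{-\kappa}=\sum_{n=0}^\infty q_n(x;y_0)\,r^n ,$$ and let $$\nu(n)=2^n(6\kappa+1)_s\left(5\kappa+\tfrac12\right)_t,\qquad s=\lfloor n/2\rfloor,\ t=\lfloor (n+1)/2\rfloor .$$ (i) If $\kappa$ is a nonnegative real number, or a formal parameter (that is, transcendental over $\mathbb R$), then there is exactly one intertwining operator $V$, and $\nu(n)\ne0$ for all $n\ge0$. (ii) For every $\kappa\in\mathbb F$, every intertwining operator $V$, every $y_0\in\mathcal I$ and every $n\ge0$ with $\nu(n)\neq0$,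 $$V\left(\langle x,y_0\rangle^n\right)=\frac{n!}{\nu(n)}\,q_n(x;y_0).$$ -/

import Mathlib

open MvPolynomial

noncomputable section

namespace DunklH3

/-- The fifteen positive roots of type `H₃`; `Real.goldenRatio` is `τ = (1 + √5) / 2`. -/
def posRoot : Fin 15 → Fin 3 → ℝ :=
  let τ := Real.goldenRatio
  ![![2, 0, 0], ![0, 2, 0], ![0, 0, 2],
    ![τ, τ⁻¹, 1], ![τ, τ⁻¹, -1], ![τ, -τ⁻¹, 1], ![τ, -τ⁻¹, -1],
    ![1, τ, τ⁻¹], ![1, τ, -τ⁻¹], ![-1, τ, τ⁻¹], ![-1, τ, -τ⁻¹],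
    ![τ⁻¹, 1, τ], ![τ⁻¹, -1, τ], ![-τ⁻¹, 1, τ], ![τ⁻¹, 1, -τ]]

/-- The twelve vertices of the regular icosahedron. -/
def icosVertex : Fin 12 → Fin 3 → ℝ :=
  let τ := Real.goldenRatio
  ![![0, τ, 1], ![0, τ, -1], ![0, -τ, 1], ![0, -τ, -1],
    ![1, 0, τ], ![1, 0, -τ], ![-1, 0, τ], ![-1, 0, -τ],
    ![τ, 1, 0], ![τ, -1, 0], ![-τ, 1, 0], ![-τ, -1, 0]]

/-- The vertex set `𝓘` of the icosahedron. -/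
def icosahedron : Set (Fin 3 → ℝ) := Set.range icosVertex

variable {F : Type*} [Field F] [Algebra ℝ F]

variable (F) in
/-- The linear form `⟨x, a⟩`, as a polynomial in `x = (x₁, x₂, x₃)`. -/
def linForm (a : Fin 3 → ℝ) : MvPolynomial (Fin 3) F :=
  ∑ i, C (algebraMap ℝ F (a i)) * X i

variable (F) in
/-- The action `(σ_v p)(x) = p(x σ_v)`, where `x σ_v = x - (2 ⟨x, v⟩ / |v|²) v`. -/
def reflect (v : Fin 3 → ℝ) : MvPolynomial (Fin 3) F →ₐ[F] MvPolynomial (Fin 3) F :=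
  aeval fun i => X i - C (algebraMap ℝ F (2 * v i / ∑ j, v j ^ 2)) * linForm F v

theorem linForm_dvd_sub_reflect (v : Fin 3 → ℝ) (p : MvPolynomial (Fin 3) F) :
    linForm F v ∣ p - reflect F v p := by
  induction p using MvPolynomial.induction_on with
  | C a => simp [reflect]
  | add p q hp hq =>
    have h := dvd_add hp hq
    rw [map_add]
    convert h using 1
    ring
  | mul_X p i hp =>
    have hX : reflect F v (X i)
        = X i - C (algebraMap ℝ F (2 * v i / ∑ j, v j ^ 2)) * linForm F v := by
      simp [reflect]
    obtain ⟨g, hg⟩ := hp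
    refine ⟨g * X i + reflect F v p * C (algebraMap ℝ F (2 * v i / ∑ j, v j ^ 2)), ?_⟩
    rw [map_mul, hX]
    linear_combination X i * hg

/-- The polynomial `(p(x) - p(x σ_v)) / ⟨x, v⟩`. -/
def divDiff (v : Fin 3 → ℝ) (p : MvPolynomial (Fin 3) F) : MvPolynomial (Fin 3) F :=
  (linForm_dvd_sub_reflect v p).choose

theorem linForm_mul_divDiff (v : Fin 3 → ℝ) (p : MvPolynomial (Fin 3) F) :
    linForm F v * divDiff v p = p - reflect F v p :=
  (linForm_dvd_sub_reflect v p).choose_spec.symm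

/-- The Dunkl operator `𝓓ᵢ` of type `H₃` with parameter `κ`. -/
def dunkl (κ : F) (i : Fin 3) (p : MvPolynomial (Fin 3) F) : MvPolynomial (Fin 3) F :=
  pderiv i p +
    ∑ k, C (κ * algebraMap ℝ F (posRoot k i)) * divDiff (posRoot k) p

/-- The directional Dunkl operator `⟨u, ∇_κ⟩ = ∑ᵢ uᵢ 𝓓ᵢ`. -/
def dunklDir (κ : F) (u : Fin 3 → ℝ) (p : MvPolynomial (Fin 3) F) : MvPolynomial (Fin 3) F :=
  ∑ i, C (algebraMap ℝ F (u i)) * dunkl κ i p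

/-- The directional derivative `⟨u, ∇⟩ = ∑ᵢ uᵢ ∂/∂xᵢ`. -/
def derivDir (u : Fin 3 → ℝ) (p : MvPolynomial (Fin 3) F) : MvPolynomial (Fin 3) F :=
  ∑ i, C (algebraMap ℝ F (u i)) * pderiv i p

/-- `V` is an intertwining operator for the Dunkl operators with parameter `κ`: it is linear,
`⟨u, ∇_κ⟩ V p = V ⟨u, ∇⟩ p`, `V 1 = 1`, and `V` maps homogeneous polynomials of degree `n`
to homogeneous polynomials of degree `n`. -/
structure IsIntertwining (κ : F)
    (V : MvPolynomial (Fin 3) F →ₗ[F] MvPolynomial (Fin 3) F) : Prop where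
  intertwines : ∀ (u : Fin 3 → ℝ) (p : MvPolynomial (Fin 3) F),
    dunklDir κ u (V p) = V (derivDir u p)
  map_one : V 1 = 1
  homogeneous : ∀ (n : ℕ) (p : MvPolynomial (Fin 3) F),
    p.IsHomogeneous n → (V p).IsHomogeneous n

/-- The formal binomial series `(1 - r a)^(-c) = ∑ₙ ((c)ₙ / n!) aⁿ rⁿ` in the variable `r`. -/
def negPowSeries (a : MvPolynomial (Fin 3) F) (c : F) : PowerSeries (MvPolynomial (Fin 3) F) :=
  PowerSeries.mk fun n => C ((ascPochhammer F n).eval c / (n.factorial : F)) * a ^ n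

/-- The generating function
`F(r, x; y₀) = (1 - r ⟨x, y₀⟩)⁻¹ ∏_{y ∈ 𝓘} (1 - r ⟨x, y⟩)^(-κ)`, as a power series in `r`. -/
def genFun (κ : F) (y₀ : Fin 3 → ℝ) : PowerSeries (MvPolynomial (Fin 3) F) :=
  negPowSeries (linForm F y₀) 1 * ∏ j, negPowSeries (linForm F (icosVertex j)) κ

/-- The polynomial `qₙ(x; y₀)`: the coefficient of `rⁿ` in `F(r, x; y₀)`. -/
def q (κ : F) (n : ℕ) (y₀ : Fin 3 → ℝ) : MvPolynomial (Fin 3) F :=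
  PowerSeries.coeff n (genFun κ y₀)

/-- `ν(n) = 2ⁿ (6κ + 1)_s (5κ + 1/2)_t` with `s = ⌊n/2⌋` and `t = ⌊(n+1)/2⌋`. -/
def nu (κ : F) (n : ℕ) : F :=
  2 ^ n * (ascPochhammer F (n / 2)).eval (6 * κ + 1) *
    (ascPochhammer F ((n + 1) / 2)).eval (5 * κ + 1 / 2)

end DunklH3

end

/-! Let `W_n p = (1/n!) ⟨x, ∇_κ⟩ⁿ p`, where `x` is held fixed while the Dunkl operators act on `p`
(`dunklTaylor`). Since the Dunkl operators commute (`dunklDir_comm`), `∂_j W_{n+1} = W_n 𝓓_j`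
(`pderiv_dunklTaylor`). Euler's identity shows that any intertwining `V` satisfies `W_n V = id` in
degree `n`, and by finite dimension `W_n` is then bijective there. So `V` is the inverse of `W_n` in
each degree: it is unique whenever it exists, and it exists as soon as no nonzero homogeneous
polynomial of positive degree is killed by all `𝓓_i` (`exists_isIntertwining`).

Such a singular polynomial `p` of degree `n > 0` satisfies `n p + κ ∑_v (p - p σ_v) = 0` by
`sum_X_mul_dunkl`. If `κ` is transcendental, this makes `-n/κ` an eigenvalue of an operator defined
over `ℝ`, hence algebraic, a contradiction. If `κ ≥ 0` is real, a maximum principle forces `p = 0`.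

For the formula, write `G(r)` for the generating function and `y` for `y₀`. Each vertex other than
`±y` is the image of `y` under exactly one of the 15 reflections, `-y` under none, and `y` is fixed
by the rest. This collapses the sum over roots to a sum over vertices, and `𝓓_i G = y_i [r (rG)' + κ
r (11 G(r) - G(-r))]` (`dunkl_coeff_genFun`). Thus `𝓓_i q_{n+1} = y_i (n + 1 + κ(11 - (-1)ⁿ)) q_n`,
and these factors multiply up to `ν(n)`. Hence `W_n q_n = (ν(n)/n!) ⟨x, y⟩ⁿ`, and inverting `W_n`
gives the formula. -/

noncomputable section

namespace DunklH3

/-! ### Exact coordinates in `ℤ[ω]`, where finite identities are decidable. -/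

section GoldenIntegers

open QuadraticAlgebra

/-- The evaluation `ω ↦ (1 + √5) / 2` of the ring `ℤ[ω]`, `ω² = 1 + ω`. -/
def goldenEval : QuadraticAlgebra ℤ 1 1 →ₐ[ℤ] ℝ :=
  QuadraticAlgebra.lift ⟨Real.goldenRatio, by
    rw [← pow_two, Real.goldenRatio_sq]; simp [add_comm]⟩

theorem goldenEval_omega : goldenEval ω = Real.goldenRatio := by
  simp [goldenEval]

/-- The positive roots, with coordinates in `ℤ[ω]`. -/
def goldenRoot : Fin 15 → Fin 3 → QuadraticAlgebra ℤ 1 1 :=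
  ![![2, 0, 0], ![0, 2, 0], ![0, 0, 2], ![ω, ω - 1, 1], ![ω, ω - 1, -1],
    ![ω, 1 - ω, 1], ![ω, 1 - ω, -1], ![1, ω, ω - 1], ![1, ω, 1 - ω], ![-1, ω, ω - 1],
    ![-1, ω, 1 - ω], ![ω - 1, 1, ω], ![ω - 1, -1, ω], ![1 - ω, 1, ω], ![ω - 1, 1, -ω]]

/-- The vertices of the icosahedron, with coordinates in `ℤ[ω]`. -/
def goldenVertex : Fin 12 → Fin 3 → QuadraticAlgebra ℤ 1 1 :=
  ![![0, ω, 1], ![0, ω, -1], ![0, -ω, 1], ![0, -ω, -1],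
    ![1, 0, ω], ![1, 0, -ω], ![-1, 0, ω], ![-1, 0, -ω],
    ![ω, 1, 0], ![ω, -1, 0], ![-ω, 1, 0], ![-ω, -1, 0]]

/-- The relation `τ⁻¹ = τ - 1` is what makes every coordinate integral over `ℤ[ω]`. -/
theorem goldenEval_root (k : Fin 15) (i : Fin 3) :
    goldenEval (goldenRoot k i) = posRoot k i := by
  have h : Real.goldenRatio⁻¹ = Real.goldenRatio - 1 := by
    rw [Real.inv_goldenRatio, ← Real.one_sub_goldenRatio]; ring
  fin_cases k <;> fin_cases i <;>
    simp [goldenRoot, posRoot, goldenEval_omega, h, map_ofNat goldenEval 2]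

theorem goldenEval_vertex (j : Fin 12) (i : Fin 3) :
    goldenEval (goldenVertex j i) = icosVertex j i := by
  fin_cases j <;> fin_cases i <;>
    simp [goldenVertex, icosVertex, goldenEval_omega]

end GoldenIntegers

/-! ### Action of the 15 reflections on roots and vertices. -/

/-- The permutation of the positive roots, up to sign, by the reflection of the `l`-th root. -/
def rootPerm : Fin 15 → Fin 15 → Fin 15 :=
  ![![0, 1, 2, 6, 5, 4, 3, 9, 10, 7, 8, 13, 14, 11, 12],
    ![0, 1, 2, 5, 6, 3, 4, 10, 9, 8, 7, 12, 11, 14, 13],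
    ![0, 1, 2, 4, 3, 6, 5, 8, 7, 10, 9, 14, 13, 12, 11],
    ![11, 10, 4, 3, 2, 7, 13, 5, 12, 9, 1, 0, 8, 6, 14],
    ![14, 9, 3, 2, 4, 12, 8, 13, 6, 1, 10, 11, 5, 7, 0],
    ![12, 7, 6, 10, 14, 5, 2, 1, 8, 11, 3, 9, 0, 13, 4],
    ![13, 8, 5, 11, 9, 2, 6, 7, 1, 4, 14, 3, 12, 0, 10],
    ![9, 3, 14, 1, 13, 10, 6, 7, 11, 0, 5, 8, 12, 4, 2],
    ![10, 4, 11, 12, 1, 5, 9, 14, 8, 6, 0, 2, 3, 13, 7],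
    ![7, 6, 12, 3, 8, 11, 1, 0, 4, 9, 13, 5, 2, 10, 14],
    ![8, 5, 13, 7, 4, 1, 14, 3, 0, 12, 10, 11, 9, 2, 6],
    ![6, 12, 7, 13, 4, 9, 0, 2, 14, 5, 10, 11, 1, 3, 8],
    ![4, 11, 10, 8, 0, 14, 6, 7, 3, 13, 2, 1, 12, 9, 5],
    ![3, 14, 9, 0, 7, 5, 11, 4, 8, 2, 12, 6, 10, 13, 1],
    ![5, 13, 8, 3, 12, 0, 10, 11, 2, 9, 6, 7, 4, 1, 14]]

/-- The permutation of the vertices by the reflection of the `l`-th root. -/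
def vertexPerm : Fin 15 → Fin 12 → Fin 12 :=
  ![![0, 1, 2, 3, 6, 7, 4, 5, 10, 11, 8, 9], ![2, 3, 0, 1, 4, 5, 6, 7, 9, 8, 11, 10],
    ![1, 0, 3, 2, 5, 4, 7, 6, 8, 9, 10, 11], ![10, 1, 2, 9, 11, 5, 6, 8, 7, 3, 0, 4],
    ![0, 10, 9, 3, 4, 11, 8, 7, 6, 2, 1, 5], ![0, 8, 11, 3, 10, 5, 6, 9, 1, 7, 4, 2],
    ![8, 1, 2, 11, 4, 10, 9, 7, 0, 6, 5, 3], ![11, 7, 4, 8, 2, 5, 6, 1, 3, 9, 10, 0],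
    ![6, 11, 8, 5, 4, 3, 0, 7, 2, 9, 10, 1], ![9, 5, 6, 10, 4, 1, 2, 7, 8, 0, 3, 11],
    ![4, 9, 10, 7, 0, 5, 6, 3, 8, 1, 2, 11], ![7, 1, 2, 4, 3, 8, 11, 0, 5, 9, 10, 6],
    ![0, 4, 7, 3, 1, 9, 10, 2, 8, 5, 6, 11], ![5, 1, 2, 6, 9, 0, 3, 10, 8, 4, 7, 11],
    ![0, 6, 5, 3, 8, 2, 1, 11, 4, 9, 10, 7]]

/-- The index of the vertex opposite to the `j`-th one. -/
def vertexNeg : Fin 12 → Fin 12 := ![3, 2, 1, 0, 7, 6, 5, 4, 11, 10, 9, 8]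

theorem rootPerm_involutive (l : Fin 15) : Function.Involutive (rootPerm l) := by
  revert l; unfold Function.Involutive; decide

theorem vertexPerm_involutive (l : Fin 15) : Function.Involutive (vertexPerm l) := by
  revert l; unfold Function.Involutive; decide

theorem vertexNeg_involutive : Function.Involutive vertexNeg := by
  unfold Function.Involutive; decide

theorem vertexNeg_ne (j : Fin 12) : vertexNeg j ≠ j := by
  revert j; decide

/-- The combinatorial fact special to the icosahedron; it turns sums over roots into sums over
vertices. -/
theorem card_vertexPerm_eq (j m : Fin 12) (hj : m ≠ j) :
    (Finset.univ.filter fun k => vertexPerm k j = m).card = if m = vertexNeg j then 0 else 1 := by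
  revert j m; decide

theorem goldenRoot_normSq (k : Fin 15) : ∑ i, goldenRoot k i ^ 2 = 4 := by
  revert k; decide

/-- All roots have squared length 4, so the reflection is `a - (⟨a, v⟩ / 2) v`; both sides are
doubled to stay in `ℤ[ω]`. -/
theorem goldenRoot_rootPerm (l k : Fin 15) :
    (∀ i, 2 * goldenRoot (rootPerm l k) i =
      2 * goldenRoot k i - (∑ j, goldenRoot k j * goldenRoot l j) * goldenRoot l i) ∨
    (∀ i, 2 * goldenRoot (rootPerm l k) i =
      -(2 * goldenRoot k i - (∑ j, goldenRoot k j * goldenRoot l j) * goldenRoot l i)) := by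
  revert l k; decide

theorem goldenVertex_vertexPerm (l : Fin 15) (k : Fin 12) (i : Fin 3) :
    2 * goldenVertex (vertexPerm l k) i =
      2 * goldenVertex k i - (∑ j, goldenVertex k j * goldenRoot l j) * goldenRoot l i := by
  revert l k i; decide

theorem goldenVertex_vertexNeg (j : Fin 12) (i : Fin 3) :
    goldenVertex (vertexNeg j) i = -goldenVertex j i := by
  revert j i; decide

theorem posRoot_normSq (k : Fin 15) : ∑ i, posRoot k i ^ 2 = 4 := by
  have h := congrArg goldenEval (goldenRoot_normSq k)
  simpa [goldenEval_root, map_ofNat goldenEval 4] using h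

theorem posRoot_ne_zero (k : Fin 15) : posRoot k ≠ 0 := by
  intro h
  simpa [h] using posRoot_normSq k

/-- The reflection of `ℝ³` in the plane orthogonal to `v`. -/
def vecReflect (v a : Fin 3 → ℝ) : Fin 3 → ℝ :=
  fun i => a i - 2 * (∑ j, a j * v j) / (∑ j, v j ^ 2) * v i

theorem vecReflect_posRoot (k : Fin 15) (a : Fin 3 → ℝ) (i : Fin 3) :
    vecReflect (posRoot k) a i = a i - (∑ j, a j * posRoot k j) / 2 * posRoot k i := by
  rw [vecReflect, posRoot_normSq]; ring

theorem posRoot_rootPerm (l k : Fin 15) :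
    posRoot (rootPerm l k) = vecReflect (posRoot l) (posRoot k) ∨
      posRoot (rootPerm l k) = -vecReflect (posRoot l) (posRoot k) := by
  refine (goldenRoot_rootPerm l k).imp ?_ ?_ <;>
  · intro h
    ext i
    have hi := congrArg goldenEval (h i)
    simp only [map_mul, map_sub, map_neg, map_sum, map_ofNat goldenEval 2, goldenEval_root] at hi
    simp only [Pi.neg_apply, vecReflect_posRoot]
    linear_combination hi / 2

theorem icosVertex_vertexPerm (l : Fin 15) (k : Fin 12) :
    icosVertex (vertexPerm l k) = vecReflect (posRoot l) (icosVertex k) := by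
  ext i
  have hi := congrArg goldenEval (goldenVertex_vertexPerm l k i)
  simp only [map_mul, map_sub, map_sum, map_ofNat goldenEval 2, goldenEval_root,
    goldenEval_vertex] at hi
  rw [vecReflect_posRoot]
  linear_combination hi / 2

theorem icosVertex_vertexNeg (j : Fin 12) : icosVertex (vertexNeg j) = -icosVertex j := by
  ext i
  have hi := congrArg goldenEval (goldenVertex_vertexNeg j i)
  simpa [goldenEval_vertex] using hi

theorem vecReflect_neg_left (v a : Fin 3 → ℝ) : vecReflect (-v) a = vecReflect v a := by
  ext i
  simp only [vecReflect, Pi.neg_apply, mul_neg, Finset.sum_neg_distrib, neg_sq]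
  ring

theorem sum_vecReflect_mul {v : Fin 3 → ℝ} (hv : v ≠ 0) (a b : Fin 3 → ℝ) :
    ∑ i, vecReflect v a i * vecReflect v b i = ∑ i, a i * b i := by
  have h : ∑ j, v j ^ 2 ≠ 0 := by
    contrapose! hv
    rw [Finset.sum_eq_zero_iff_of_nonneg fun i _ => sq_nonneg _] at hv
    ext i
    simpa using hv i
  simp only [vecReflect, Fin.sum_univ_three] at h ⊢
  field_simp
  ring

/-- The conjugation rule `σ_v σ_w σ_v = σ_{w σ_v}`, a consequence of `σ_v` being an isometry. -/
theorem vecReflect_vecReflect {v : Fin 3 → ℝ} (hv : v ≠ 0) (w a : Fin 3 → ℝ) :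
    vecReflect v (vecReflect w a) = vecReflect (vecReflect v w) (vecReflect v a) := by
  ext i
  have h := sum_vecReflect_mul hv w w
  simp only [← pow_two] at h
  rw [vecReflect.eq_def (vecReflect v w), h, sum_vecReflect_mul hv]
  simp only [vecReflect, Fin.sum_univ_three]
  ring

theorem vecReflect_self_inv {v : Fin 3 → ℝ} (hv : v ≠ 0) (a : Fin 3 → ℝ) :
    vecReflect v (vecReflect v a) = a := by
  have h : ∑ j, v j ^ 2 ≠ 0 := by
    contrapose! hv
    rw [Finset.sum_eq_zero_iff_of_nonneg fun i _ => sq_nonneg _] at hv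
    ext i
    simpa using hv i
  ext i
  simp only [vecReflect, Fin.sum_univ_three] at h ⊢
  field_simp
  ring

/-! ### Dunkl operators: equivariance, commutativity and degree. -/

section

variable {F : Type*} [Field F] [Algebra ℝ F]

theorem linForm_add (a b : Fin 3 → ℝ) : linForm F (a + b) = linForm F a + linForm F b := by
  simp [linForm, add_mul, Finset.sum_add_distrib]

theorem linForm_smul (c : ℝ) (a : Fin 3 → ℝ) :
    linForm F (c • a) = C (algebraMap ℝ F c) * linForm F a := by
  simp [linForm, mul_assoc, Finset.mul_sum]

theorem linForm_neg (a : Fin 3 → ℝ) : linForm F (-a) = -linForm F a := by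
  simp [linForm]

theorem linForm_sub (a b : Fin 3 → ℝ) : linForm F (a - b) = linForm F a - linForm F b := by
  rw [sub_eq_add_neg, linForm_add, linForm_neg, sub_eq_add_neg]

theorem linForm_single (i : Fin 3) : linForm F (Pi.single i 1) = X i := by
  simp [linForm, Pi.single_apply, ite_mul, apply_ite C, apply_ite (algebraMap ℝ F)]

theorem pderiv_linForm (i : Fin 3) (a : Fin 3 → ℝ) :
    pderiv i (linForm F a) = C (algebraMap ℝ F (a i)) := by
  simp [linForm, pderiv_X, Pi.single_apply]

theorem linForm_ne_zero {v : Fin 3 → ℝ} (hv : v ≠ 0) : linForm F v ≠ 0 := by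
  contrapose! hv
  ext i
  have h := pderiv_linForm (F := F) i v
  rw [hv, map_zero] at h
  simpa using h.symm

theorem isHomogeneous_linForm (a : Fin 3 → ℝ) : (linForm F a).IsHomogeneous 1 :=
  IsHomogeneous.sum _ _ _ fun i _ => isHomogeneous_C_mul_X _ i

theorem vecReflect_eq (v a : Fin 3 → ℝ) :
    vecReflect v a = a - (2 * (a ⬝ᵥ v) / ∑ j, v j ^ 2) • v := by
  ext i; simp [vecReflect, dotProduct]

theorem vecReflect_posRoot_eq (k : Fin 15) (a : Fin 3 → ℝ) :
    vecReflect (posRoot k) a = a - ((a ⬝ᵥ posRoot k) / 2) • posRoot k := by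
  ext i; simp [vecReflect_posRoot, dotProduct]

theorem vecReflect_ne_zero {v w : Fin 3 → ℝ} (hv : v ≠ 0) (hw : w ≠ 0) : vecReflect v w ≠ 0 := by
  intro h
  apply hw
  rw [← vecReflect_self_inv hv w, h]
  ext i; simp [vecReflect]

theorem reflect_X (v : Fin 3 → ℝ) (i : Fin 3) : reflect F v (X i) =
    X i - C (algebraMap ℝ F (2 * v i / ∑ j, v j ^ 2)) * linForm F v := by
  simp [reflect]

theorem reflect_C (v : Fin 3 → ℝ) (c : F) : reflect F v (C c) = C c := by
  simp [reflect]

theorem reflect_linForm (v a : Fin 3 → ℝ) :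
    reflect F v (linForm F a) = linForm F (vecReflect v a) := by
  rw [vecReflect_eq, linForm_sub, linForm_smul, linForm, map_sum]
  simp only [map_mul, reflect_C, reflect_X, mul_sub, Finset.sum_sub_distrib]
  congr 1
  simp only [← mul_assoc, ← Finset.sum_mul, ← map_mul, ← map_sum]
  congr 3
  simp only [dotProduct, Fin.sum_univ_three]
  ring

theorem reflect_reflect {v : Fin 3 → ℝ} (hv : v ≠ 0) (w : Fin 3 → ℝ)
    (p : MvPolynomial (Fin 3) F) :
    reflect F v (reflect F w p) = reflect F (vecReflect v w) (reflect F v p) := by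
  have h : (reflect F v).comp (reflect F w) = (reflect F (vecReflect v w)).comp (reflect F v) := by
    apply MvPolynomial.algHom_ext
    intro i
    simp only [AlgHom.comp_apply, ← linForm_single, reflect_linForm, vecReflect_vecReflect hv]
  exact DFunLike.congr_fun h p

theorem reflect_neg (v : Fin 3 → ℝ) (p : MvPolynomial (Fin 3) F) :
    reflect F (-v) p = reflect F v p := by
  have h : reflect F (-v) = reflect F v := by
    apply MvPolynomial.algHom_ext
    intro i
    simp only [← linForm_single, reflect_linForm, vecReflect_neg_left]
  rw [h]

theorem isHomogeneous_reflect (v : Fin 3 → ℝ) {n : ℕ} {p : MvPolynomial (Fin 3) F}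
    (hp : p.IsHomogeneous n) : (reflect F v p).IsHomogeneous n := by
  have h := hp.aeval (n := 1)
    (fun i => X i - C (algebraMap ℝ F (2 * v i / ∑ j, v j ^ 2)) * linForm F v)
    (fun i => (isHomogeneous_X F i).sub ((isHomogeneous_linForm v).C_mul _))
  rwa [one_mul] at h

/-- `divDiff` is a chosen quotient; cancelling `⟨x, v⟩` pins it down, and all its rules follow from
this. -/
theorem divDiff_eq_of_mul_eq {v : Fin 3 → ℝ} (hv : v ≠ 0) {p g : MvPolynomial (Fin 3) F}
    (h : linForm F v * g = p - reflect F v p) : divDiff v p = g :=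
  mul_left_cancel₀ (linForm_ne_zero hv) ((linForm_mul_divDiff v p).trans h.symm)

theorem divDiff_add {v : Fin 3 → ℝ} (hv : v ≠ 0) (p g : MvPolynomial (Fin 3) F) :
    divDiff v (p + g) = divDiff v p + divDiff v g :=
  divDiff_eq_of_mul_eq hv (by
    rw [mul_add, linForm_mul_divDiff, linForm_mul_divDiff, map_add]; ring)

theorem divDiff_C_mul {v : Fin 3 → ℝ} (hv : v ≠ 0) (c : F) (p : MvPolynomial (Fin 3) F) :
    divDiff v (C c * p) = C c * divDiff v p :=
  divDiff_eq_of_mul_eq hv (by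
    rw [mul_left_comm, linForm_mul_divDiff, map_mul, reflect_C]; ring)

theorem divDiff_C {v : Fin 3 → ℝ} (hv : v ≠ 0) (c : F) :
    divDiff v (C c) = 0 :=
  divDiff_eq_of_mul_eq hv (by rw [reflect_C]; ring)

theorem divDiff_neg {v : Fin 3 → ℝ} (hv : v ≠ 0) (p : MvPolynomial (Fin 3) F) :
    divDiff (-v) p = -divDiff v p :=
  divDiff_eq_of_mul_eq (neg_ne_zero.2 hv) (by
    rw [linForm_neg, neg_mul_neg, linForm_mul_divDiff, reflect_neg])

theorem divDiff_linForm_mul {v : Fin 3 → ℝ} (hv : v ≠ 0) (c : Fin 3 → ℝ)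
    (p : MvPolynomial (Fin 3) F) :
    divDiff v (linForm F c * p) = linForm F c * divDiff v p +
      C (algebraMap ℝ F (2 * (c ⬝ᵥ v) / ∑ j, v j ^ 2)) * reflect F v p :=
  divDiff_eq_of_mul_eq hv (by
    rw [map_mul, reflect_linForm, vecReflect_eq, linForm_sub, linForm_smul]
    linear_combination linForm F c * linForm_mul_divDiff v p)

theorem reflect_divDiff {v w : Fin 3 → ℝ} (hv : v ≠ 0) (hw : w ≠ 0)
    (p : MvPolynomial (Fin 3) F) :
    reflect F v (divDiff w p) = divDiff (vecReflect v w) (reflect F v p) := by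
  refine (divDiff_eq_of_mul_eq (vecReflect_ne_zero hv hw) ?_).symm
  rw [← reflect_linForm, ← map_mul, linForm_mul_divDiff, map_sub, reflect_reflect hv]

theorem derivDir_add (u : Fin 3 → ℝ) (p g : MvPolynomial (Fin 3) F) :
    derivDir u (p + g) = derivDir u p + derivDir u g := by
  simp [derivDir, mul_add, Finset.sum_add_distrib]

theorem derivDir_C (u : Fin 3 → ℝ) (c : F) : derivDir u (C c) = 0 := by
  simp [derivDir]

theorem derivDir_mul (u : Fin 3 → ℝ) (p g : MvPolynomial (Fin 3) F) :
    derivDir u (p * g) = p * derivDir u g + derivDir u p * g := by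
  simp only [derivDir, Fin.sum_univ_three, Derivation.leibniz, smul_eq_mul]
  ring

theorem derivDir_linForm (u c : Fin 3 → ℝ) :
    derivDir u (linForm F c) = C (algebraMap ℝ F (u ⬝ᵥ c)) := by
  simp [derivDir, pderiv_linForm, dotProduct]

theorem derivDir_single (i : Fin 3) (p : MvPolynomial (Fin 3) F) :
    derivDir (Pi.single i 1) p = pderiv i p := by
  simp [derivDir, Pi.single_apply, ite_mul, apply_ite C, apply_ite (algebraMap ℝ F)]

theorem dotProduct_vecReflect {v : Fin 3 → ℝ} (hv : v ≠ 0) (a b : Fin 3 → ℝ) :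
    vecReflect v a ⬝ᵥ vecReflect v b = a ⬝ᵥ b :=
  sum_vecReflect_mul hv a b

theorem reflect_derivDir {v : Fin 3 → ℝ} (hv : v ≠ 0) (u : Fin 3 → ℝ)
    (p : MvPolynomial (Fin 3) F) :
    reflect F v (derivDir u p) = derivDir (vecReflect v u) (reflect F v p) := by
  induction p using MvPolynomial.induction_on with
  | C a => simp [derivDir_C]
  | add p g hp hg => simp only [map_add, derivDir_add, hp, hg]
  | mul_X p i hp =>
    rw [← linForm_single, derivDir_mul, map_add, map_mul, map_mul, map_mul, derivDir_mul, hp,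
      derivDir_linForm, reflect_linForm, derivDir_linForm, dotProduct_vecReflect hv, reflect_C]

theorem dunklDir_eq (κ : F) (u : Fin 3 → ℝ) (p : MvPolynomial (Fin 3) F) :
    dunklDir κ u p = derivDir u p +
      ∑ k, C (κ * algebraMap ℝ F (u ⬝ᵥ posRoot k)) * divDiff (posRoot k) p := by
  simp only [dunklDir, dunkl, derivDir, mul_add, Finset.sum_add_distrib, Finset.mul_sum]
  rw [Finset.sum_comm]
  congr 1
  refine Finset.sum_congr rfl fun k _ => ?_
  simp only [← mul_assoc, ← Finset.sum_mul, ← C_mul, ← map_sum]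
  congr 2
  rw [dotProduct, map_sum, Finset.mul_sum]
  refine Finset.sum_congr rfl fun i _ => ?_
  rw [map_mul]; ring

theorem dunklDir_single (κ : F) (i : Fin 3) (p : MvPolynomial (Fin 3) F) :
    dunklDir κ (Pi.single i 1) p = dunkl κ i p := by
  simp [dunklDir, Pi.single_apply, ite_mul, apply_ite C, apply_ite (algebraMap ℝ F)]

theorem dunklDir_add (κ : F) (u : Fin 3 → ℝ) (p g : MvPolynomial (Fin 3) F) :
    dunklDir κ u (p + g) = dunklDir κ u p + dunklDir κ u g := by
  simp only [dunklDir_eq, derivDir_add, divDiff_add (posRoot_ne_zero _), mul_add,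
    Finset.sum_add_distrib]
  ring

theorem dunklDir_C_mul (κ : F) (u : Fin 3 → ℝ) (c : F) (p : MvPolynomial (Fin 3) F) :
    dunklDir κ u (C c * p) = C c * dunklDir κ u p := by
  simp only [dunklDir_eq, derivDir_mul, derivDir_C, divDiff_C_mul (posRoot_ne_zero _), mul_add,
    Finset.mul_sum, mul_left_comm, zero_mul, add_zero]

theorem dunklDir_C (κ : F) (u : Fin 3 → ℝ) (c : F) :
    dunklDir κ u (C c) = 0 := by
  simp [dunklDir_eq, derivDir_C, divDiff_C (posRoot_ne_zero _)]

/-- The directional Dunkl operator as a linear map. -/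
def dunklLin (κ : F) (u : Fin 3 → ℝ) : MvPolynomial (Fin 3) F →ₗ[F] MvPolynomial (Fin 3) F where
  toFun := dunklDir κ u
  map_add' := dunklDir_add κ u
  map_smul' c p := by simp [smul_eq_C_mul, dunklDir_C_mul]

@[simp] theorem dunklLin_apply (κ : F) (u : Fin 3 → ℝ) (p : MvPolynomial (Fin 3) F) :
    dunklLin κ u p = dunklDir κ u p := rfl

theorem dunklDir_sub_smul (κ : F) (u v : Fin 3 → ℝ) (c : ℝ) (p : MvPolynomial (Fin 3) F) :
    dunklDir κ (u - c • v) p = dunklDir κ u p - C (algebraMap ℝ F c) * dunklDir κ v p := by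
  simp [dunklDir, sub_mul, Finset.sum_sub_distrib, Finset.mul_sum, mul_assoc]

/-- A reflection permutes the positive roots only up to sign, hence the evenness assumption. -/
theorem sum_rootPerm {M : Type*} [AddCommMonoid M] (h : (Fin 3 → ℝ) → M)
    (heven : ∀ w ≠ 0, h (-w) = h w) (l : Fin 15) :
    ∑ k, h (vecReflect (posRoot l) (posRoot k)) = ∑ k, h (posRoot k) := by
  rw [← (rootPerm_involutive l).bijective.sum_comp fun k => h (posRoot k)]
  refine Finset.sum_congr rfl fun k _ => ?_
  obtain hk | hk := posRoot_rootPerm l k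
  · rw [hk]
  · rw [hk, heven _ (vecReflect_ne_zero (posRoot_ne_zero l) (posRoot_ne_zero k))]

theorem reflect_dunklDir (κ : F) (l : Fin 15) (u : Fin 3 → ℝ) (p : MvPolynomial (Fin 3) F) :
    reflect F (posRoot l) (dunklDir κ u p) =
      dunklDir κ (vecReflect (posRoot l) u) (reflect F (posRoot l) p) := by
  have hl := posRoot_ne_zero l
  rw [dunklDir_eq, dunklDir_eq, map_add, reflect_derivDir hl, map_sum]
  congr 1
  rw [← sum_rootPerm (fun w => C (κ * algebraMap ℝ F (vecReflect (posRoot l) u ⬝ᵥ w)) *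
    divDiff w (reflect F (posRoot l) p)) _ l]
  · refine Finset.sum_congr rfl fun k _ => ?_
    rw [map_mul, reflect_C, reflect_divDiff hl (posRoot_ne_zero k), dotProduct_vecReflect hl]
  · intro w hw
    simp [divDiff_neg hw]

theorem dunklDir_linForm_mul (κ : F) (u c : Fin 3 → ℝ) (p : MvPolynomial (Fin 3) F) :
    dunklDir κ u (linForm F c * p) = linForm F c * dunklDir κ u p +
      C (algebraMap ℝ F (u ⬝ᵥ c)) * p +
      ∑ k, C (κ * algebraMap ℝ F ((u ⬝ᵥ posRoot k) * (c ⬝ᵥ posRoot k) / 2)) *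
        reflect F (posRoot k) p := by
  simp only [dunklDir_eq, derivDir_mul, derivDir_linForm, divDiff_linForm_mul (posRoot_ne_zero _),
    posRoot_normSq, mul_add, Finset.sum_add_distrib, Finset.mul_sum]
  have h : ∀ k, C (κ * algebraMap ℝ F (u ⬝ᵥ posRoot k)) *
      (C (algebraMap ℝ F (2 * c ⬝ᵥ posRoot k / 4)) * reflect F (posRoot k) p) =
      C (κ * algebraMap ℝ F ((u ⬝ᵥ posRoot k) * (c ⬝ᵥ posRoot k) / 2)) *
        reflect F (posRoot k) p := by
    intro k
    rw [← mul_assoc, ← C_mul, mul_assoc, ← map_mul]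
    congr 4
    ring
  simp only [h, mul_left_comm _ (linForm F c)]
  ring

/-- Apart from the term containing `dunklDir κ a (dunklDir κ b p)`, the right side is symmetric in
`a` and `b`. This is the induction step for commutativity. -/
theorem dunklDir_dunklDir_linForm_mul (κ : F) (a b c : Fin 3 → ℝ) (p : MvPolynomial (Fin 3) F) :
    dunklDir κ a (dunklDir κ b (linForm F c * p)) =
      linForm F c * dunklDir κ a (dunklDir κ b p) +
      (C (algebraMap ℝ F (a ⬝ᵥ c)) * dunklDir κ b p +
        C (algebraMap ℝ F (b ⬝ᵥ c)) * dunklDir κ a p) +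
      (∑ k, C (κ * algebraMap ℝ F ((a ⬝ᵥ posRoot k) * (c ⬝ᵥ posRoot k) / 2)) *
          reflect F (posRoot k) (dunklDir κ b p) +
        ∑ k, C (κ * algebraMap ℝ F ((b ⬝ᵥ posRoot k) * (c ⬝ᵥ posRoot k) / 2)) *
          reflect F (posRoot k) (dunklDir κ a p)) -
      ∑ k, C (κ * algebraMap ℝ F
          ((a ⬝ᵥ posRoot k) * (b ⬝ᵥ posRoot k) * (c ⬝ᵥ posRoot k) / 4)) *
        reflect F (posRoot k) (dunklDir κ (posRoot k) p) := by
  -- Equivariance moves the operator past `σ_k`, and linearity in the direction expands the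
  -- reflected `a`.
  have hk : ∀ k, dunklDir κ a (reflect F (posRoot k) p) =
      reflect F (posRoot k) (dunklDir κ a p) - C (algebraMap ℝ F ((a ⬝ᵥ posRoot k) / 2)) *
        reflect F (posRoot k) (dunklDir κ (posRoot k) p) := by
    intro k
    have h := reflect_dunklDir κ k (vecReflect (posRoot k) a) p
    rw [vecReflect_self_inv (posRoot_ne_zero k), vecReflect_posRoot_eq, dunklDir_sub_smul,
      map_sub, map_mul, reflect_C] at h
    exact h.symm
  have hs : dunklDir κ a (∑ k, C (κ * algebraMap ℝ F ((b ⬝ᵥ posRoot k) * (c ⬝ᵥ posRoot k) / 2)) *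
      reflect F (posRoot k) p) =
      ∑ k, C (κ * algebraMap ℝ F ((b ⬝ᵥ posRoot k) * (c ⬝ᵥ posRoot k) / 2)) *
          reflect F (posRoot k) (dunklDir κ a p) -
      ∑ k, C (κ * algebraMap ℝ F
          ((a ⬝ᵥ posRoot k) * (b ⬝ᵥ posRoot k) * (c ⬝ᵥ posRoot k) / 4)) *
        reflect F (posRoot k) (dunklDir κ (posRoot k) p) := by
    rw [← dunklLin_apply, map_sum, ← Finset.sum_sub_distrib]
    refine Finset.sum_congr rfl fun k _ => ?_
    rw [dunklLin_apply, dunklDir_C_mul, hk, mul_sub, ← mul_assoc, ← C_mul, mul_assoc κ, ← map_mul]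
    congr 5
    ring
  rw [dunklDir_linForm_mul κ b, dunklDir_add, dunklDir_add, hs, dunklDir_C_mul,
    dunklDir_linForm_mul κ a]
  ring

theorem dunklDir_comm (κ : F) (a b : Fin 3 → ℝ) (p : MvPolynomial (Fin 3) F) :
    dunklDir κ a (dunklDir κ b p) = dunklDir κ b (dunklDir κ a p) := by
  induction p using MvPolynomial.induction_on with
  | C c => rw [dunklDir_C, dunklDir_C, ← C_0, dunklDir_C, dunklDir_C]
  | add p g hp hg => simp only [dunklDir_add, hp, hg]
  | mul_X p i hp =>
    rw [mul_comm, ← linForm_single, dunklDir_dunklDir_linForm_mul, dunklDir_dunklDir_linForm_mul,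
      hp]
    simp only [mul_comm (a ⬝ᵥ posRoot _) (b ⬝ᵥ posRoot _)]
    ring

theorem charZero_of_algebra_real (F : Type*) [Field F] [Algebra ℝ F] : CharZero F :=
  charZero_of_injective_algebraMap (algebraMap ℝ F).injective

theorem exists_eq_C_of_isHomogeneous {R σ : Type*} [CommSemiring R] {p : MvPolynomial σ R}
    (hp : p.IsHomogeneous 0) :
    ∃ c, p = C c :=
  ⟨_, totalDegree_eq_zero_iff_eq_C.1 ((totalDegree_zero_iff_isHomogeneous _).2 hp)⟩

theorem eq_C_inv_mul_sum_X_mul_pderiv {n : ℕ} {p : MvPolynomial (Fin 3) F}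
    (hp : p.IsHomogeneous (n + 1)) :
    p = C ((n + 1 : F)⁻¹) * ∑ i, X i * pderiv i p := by
  have := charZero_of_algebra_real F
  have h : (n + 1 : F) ≠ 0 := by exact_mod_cast n.succ_ne_zero
  rw [hp.sum_X_mul_pderiv, nsmul_eq_mul, ← map_natCast (C : F →+* MvPolynomial (Fin 3) F),
    ← mul_assoc, ← C_mul]
  simp [h]

/-- Euler's identity writes `p` through products `x_i ∂_i p`; the twisted Leibniz rule then reduces
the claim to lower degree. -/
theorem isHomogeneous_divDiff {v : Fin 3 → ℝ} (hv : v ≠ 0) {n : ℕ} {p : MvPolynomial (Fin 3) F}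
    (hp : p.IsHomogeneous (n + 1)) : (divDiff v p).IsHomogeneous n := by
  induction n generalizing p with
  | zero =>
    rw [eq_C_inv_mul_sum_X_mul_pderiv hp, divDiff_C_mul hv]
    refine IsHomogeneous.C_mul ?_ _
    simp only [Fin.sum_univ_three, divDiff_add hv, ← linForm_single, divDiff_linForm_mul hv]
    have h : ∀ i, (pderiv i p).IsHomogeneous 0 := fun i => hp.pderiv
    have h' : ∀ i, divDiff v (pderiv i p) = 0 := fun i => by
      obtain ⟨c, hc⟩ := exists_eq_C_of_isHomogeneous (h i)
      rw [hc, divDiff_C hv]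
    simp only [h', mul_zero, zero_add]
    exact ((((isHomogeneous_reflect v (h _)).C_mul _).add
      ((isHomogeneous_reflect v (h _)).C_mul _)).add ((isHomogeneous_reflect v (h _)).C_mul _))
  | succ n ih =>
    have h : ∀ i, (divDiff v (X i * pderiv i p)).IsHomogeneous (n + 1) := fun i => by
      have h : (pderiv i p).IsHomogeneous (n + 1) := hp.pderiv
      rw [← linForm_single, divDiff_linForm_mul hv, add_comm n 1]
      refine ((isHomogeneous_linForm _).mul (ih h)).add ?_
      rw [add_comm 1 n]
      exact (isHomogeneous_reflect v h).C_mul _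
    rw [eq_C_inv_mul_sum_X_mul_pderiv hp, divDiff_C_mul hv]
    refine IsHomogeneous.C_mul ?_ _
    simp only [Fin.sum_univ_three, divDiff_add hv]
    exact ((h 0).add (h 1)).add (h 2)

theorem isHomogeneous_dunkl (κ : F) (i : Fin 3) {n : ℕ} {p : MvPolynomial (Fin 3) F}
    (hp : p.IsHomogeneous (n + 1)) : (dunkl κ i p).IsHomogeneous n :=
  IsHomogeneous.add hp.pderiv
    (IsHomogeneous.sum _ _ _ fun k _ => (isHomogeneous_divDiff (posRoot_ne_zero k) hp).C_mul _)

end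

/-! ### The inverse of the intertwining operator. -/

section

theorem linearMap_ext_of_isHomogeneous {R σ M : Type*} [CommSemiring R] [AddCommMonoid M]
    [Module R M]
    {f g : MvPolynomial σ R →ₗ[R] M}
    (h : ∀ (n : ℕ) (p : MvPolynomial σ R), p.IsHomogeneous n → f p = g p) : f = g := by
  refine (basisMonomials σ R).ext fun s => ?_
  rw [coe_basisMonomials]
  exact h _ _ (isHomogeneous_monomial 1 rfl)

variable {F : Type*} [Field F] [Algebra ℝ F]

/-- The map `p ↦ (1 / n!) ⟨y, ∇_κ⟩ⁿ p` at `y = x`: on homogeneous polynomials of degree `n` it is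
the inverse of an intertwining operator. -/
def dunklTaylor (κ : F) : ℕ → MvPolynomial (Fin 3) F →ₗ[F] MvPolynomial (Fin 3) F
  | 0 =>
    { toFun := fun p => C (constantCoeff p)
      map_add' := by simp
      map_smul' := by simp [smul_eq_C_mul] }
  | n + 1 => (n + 1 : F)⁻¹ • ∑ i, LinearMap.mulLeft F (X i) ∘ₗ
      dunklTaylor κ n ∘ₗ dunklLin κ (Pi.single i 1)

theorem dunklTaylor_zero_apply (κ : F) (p : MvPolynomial (Fin 3) F) :
    dunklTaylor κ 0 p = C (constantCoeff p) := rfl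

theorem dunklTaylor_succ_apply (κ : F) (n : ℕ) (p : MvPolynomial (Fin 3) F) :
    dunklTaylor κ (n + 1) p =
      C ((n + 1 : F)⁻¹) * ∑ i, X i * dunklTaylor κ n (dunkl κ i p) := by
  simp [dunklTaylor, smul_eq_C_mul, dunklDir_single]

theorem isHomogeneous_dunklTaylor (κ : F) (n : ℕ) (p : MvPolynomial (Fin 3) F) :
    (dunklTaylor κ n p).IsHomogeneous n := by
  induction n generalizing p with
  | zero => exact isHomogeneous_C _ _
  | succ n ih =>
    rw [dunklTaylor_succ_apply]
    refine IsHomogeneous.C_mul (IsHomogeneous.sum _ _ _ fun i _ => ?_) _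
    rw [add_comm]
    exact (isHomogeneous_X F i).mul (ih _)

/-- Commutativity enters here: the derivative yields one copy of `W_{n+1} 𝓓_j p` from the explicit
`x_j`, and `n + 1` copies from the remaining terms after swapping `𝓓_j 𝓓_i`. -/
theorem pderiv_dunklTaylor (κ : F) (n : ℕ) (j : Fin 3) (p : MvPolynomial (Fin 3) F) :
    pderiv j (dunklTaylor κ (n + 1) p) = dunklTaylor κ n (dunkl κ j p) := by
  have := charZero_of_algebra_real F
  have hX : ∀ g : Fin 3 → MvPolynomial (Fin 3) F,
      pderiv j (∑ i, X i * g i) = g j + ∑ i, X i * pderiv j (g i) := fun g => by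
    simp only [map_sum, Derivation.leibniz, pderiv_X, smul_eq_mul, Finset.sum_add_distrib]
    simp [Pi.single_apply, add_comm]
  induction n generalizing p with
  | zero =>
    rw [dunklTaylor_succ_apply, pderiv_C_mul, hX]
    simp [dunklTaylor_zero_apply]
  | succ n ih =>
    have h : (n + 1 + 1 : F) ≠ 0 := by exact_mod_cast (n + 1).succ_ne_zero
    have h1 : (n + 1 : F) ≠ 0 := by exact_mod_cast n.succ_ne_zero
    rw [dunklTaylor_succ_apply, pderiv_C_mul, hX]
    simp only [ih]
    have hc : ∀ i, dunkl κ j (dunkl κ i p) = dunkl κ i (dunkl κ j p) := fun i => by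
      simp only [← dunklDir_single, dunklDir_comm κ (Pi.single j 1)]
    have hs : ∑ i, X i * dunklTaylor κ n (dunkl κ i (dunkl κ j p)) =
        C (n + 1 : F) * dunklTaylor κ (n + 1) (dunkl κ j p) := by
      rw [dunklTaylor_succ_apply, ← mul_assoc, ← C_mul, mul_inv_cancel₀ h1, C_1, one_mul]
    simp only [hc, hs]
    rw [← one_add_mul, ← C_1, ← C_add, ← mul_assoc, ← C_mul]
    push_cast
    rw [add_comm (1 : F), inv_mul_cancel₀ h, C_1, one_mul]

theorem IsIntertwining.dunkl_apply {κ : F}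
    {V : MvPolynomial (Fin 3) F →ₗ[F] MvPolynomial (Fin 3) F} (hV : IsIntertwining κ V)
    (i : Fin 3) (p : MvPolynomial (Fin 3) F) : dunkl κ i (V p) = V (pderiv i p) := by
  rw [← dunklDir_single, hV.intertwines, derivDir_single]

theorem IsIntertwining.dunklTaylor_apply {κ : F}
    {V : MvPolynomial (Fin 3) F →ₗ[F] MvPolynomial (Fin 3) F} (hV : IsIntertwining κ V)
    {n : ℕ} {p : MvPolynomial (Fin 3) F} (hp : p.IsHomogeneous n) :
    dunklTaylor κ n (V p) = p := by
  induction n generalizing p with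
  | zero =>
    obtain ⟨c, rfl⟩ := exists_eq_C_of_isHomogeneous hp
    rw [C_eq_smul_one, map_smul, hV.map_one, ← C_eq_smul_one, dunklTaylor_zero_apply,
      constantCoeff_C]
  | succ n ih =>
    have h : ∀ i, dunklTaylor κ n (V (pderiv i p)) = pderiv i p := fun i => ih hp.pderiv
    simp only [dunklTaylor_succ_apply, hV.dunkl_apply, h]
    exact (eq_C_inv_mul_sum_X_mul_pderiv hp).symm

/-- `dunklTaylor κ n` as an endomorphism of the homogeneous polynomials of degree `n`. -/
def dunklTaylorHom (κ : F) (n : ℕ) :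
    homogeneousSubmodule (Fin 3) F n →ₗ[F] homogeneousSubmodule (Fin 3) F n :=
  (dunklTaylor κ n).restrict fun p _ => isHomogeneous_dunklTaylor κ n p

theorem dunklTaylorHom_injective_iff_surjective (κ : F) (n : ℕ) :
    Function.Injective (dunklTaylorHom κ n) ↔ Function.Surjective (dunklTaylorHom κ n) := by
  have : FiniteDimensional F (homogeneousSubmodule (Fin 3) F n) :=
    Module.Finite.iff_fg.2 (homogeneousSubmodule_fg _ _ n)
  exact LinearMap.injective_iff_surjective

/-- `V` is a right inverse of `W_n`, so `W_n` is surjective on a finite-dimensional space and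
therefore injective. Only the existence of `V` is used, whatever `κ` is. -/
theorem IsIntertwining.dunklTaylor_injOn {κ : F}
    {V : MvPolynomial (Fin 3) F →ₗ[F] MvPolynomial (Fin 3) F} (hV : IsIntertwining κ V)
    {n : ℕ} {p g : MvPolynomial (Fin 3) F} (hp : p.IsHomogeneous n) (hg : g.IsHomogeneous n)
    (h : dunklTaylor κ n p = dunklTaylor κ n g) : p = g := by
  have hinj := (dunklTaylorHom_injective_iff_surjective κ n).2 fun r =>
    ⟨⟨V r, hV.homogeneous n r r.2⟩, Subtype.ext (hV.dunklTaylor_apply r.2)⟩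
  exact congrArg Subtype.val (@hinj ⟨p, hp⟩ ⟨g, hg⟩ (Subtype.ext h))

theorem IsIntertwining.unique {κ : F}
    {V V' : MvPolynomial (Fin 3) F →ₗ[F] MvPolynomial (Fin 3) F} (hV : IsIntertwining κ V)
    (hV' : IsIntertwining κ V') : V = V' :=
  linearMap_ext_of_isHomogeneous fun n p hp =>
    hV.dunklTaylor_injOn (hV.homogeneous n p hp) (hV'.homogeneous n p hp)
      ((hV.dunklTaylor_apply hp).trans (hV'.dunklTaylor_apply hp).symm)

theorem dunklTaylor_eq_zero {κ : F}
    (hκ : ∀ (n : ℕ) (p : MvPolynomial (Fin 3) F), p.IsHomogeneous (n + 1) →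
      (∀ i, dunkl κ i p = 0) → p = 0)
    {n : ℕ} {p : MvPolynomial (Fin 3) F} (hp : p.IsHomogeneous n)
    (h : dunklTaylor κ n p = 0) : p = 0 := by
  induction n generalizing p with
  | zero =>
    obtain ⟨c, rfl⟩ := exists_eq_C_of_isHomogeneous hp
    rwa [dunklTaylor_zero_apply, constantCoeff_C] at h
  | succ n ih =>
    refine hκ n p hp fun i => ih (isHomogeneous_dunkl κ i hp) ?_
    rw [← pderiv_dunklTaylor, h, map_zero]

/-- `V` is defined on monomials by preimages under the bijections `W_n`. -/
theorem exists_isIntertwining {κ : F}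
    (hκ : ∀ (n : ℕ) (p : MvPolynomial (Fin 3) F), p.IsHomogeneous (n + 1) →
      (∀ i, dunkl κ i p = 0) → p = 0) :
    ∃ V : MvPolynomial (Fin 3) F →ₗ[F] MvPolynomial (Fin 3) F, IsIntertwining κ V := by
  have hinj : ∀ n, Function.Injective (dunklTaylorHom κ n) := fun n => by
    rw [injective_iff_map_eq_zero]
    exact fun p h => Subtype.ext (dunklTaylor_eq_zero hκ p.2 (congrArg Subtype.val h))
  have hsurj : ∀ s : Fin 3 →₀ ℕ, ∃ p : MvPolynomial (Fin 3) F, p.IsHomogeneous s.degree ∧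
      dunklTaylor κ s.degree p = monomial s 1 := fun s => by
    obtain ⟨p, hp⟩ := (dunklTaylorHom_injective_iff_surjective κ s.degree).1 (hinj _)
      ⟨monomial s 1, isHomogeneous_monomial 1 rfl⟩
    exact ⟨p, p.2, congrArg Subtype.val hp⟩
  choose f hf hWf using hsurj
  let V := (basisMonomials (Fin 3) F).constr F f
  have hVmon : ∀ s, V (monomial s 1) = f s := fun s => by
    have h := (basisMonomials (Fin 3) F).constr_basis F f s
    rwa [coe_basisMonomials] at h
  have hVsum : ∀ p, V p = ∑ s ∈ p.support, p.coeff s • f s := fun p => by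
    conv_lhs => rw [p.as_sum, map_sum]
    refine Finset.sum_congr rfl fun s _ => ?_
    rw [← hVmon, ← map_smul, smul_monomial, smul_eq_mul, mul_one]
  have hdeg : ∀ {n : ℕ} {p : MvPolynomial (Fin 3) F}, p.IsHomogeneous n →
      ∀ s ∈ p.support, s.degree = n := fun hp s hs => by
    by_contra h
    exact mem_support_iff.1 hs (hp.coeff_eq_zero h)
  have hVhom : ∀ (n : ℕ) (p : MvPolynomial (Fin 3) F), p.IsHomogeneous n →
      (V p).IsHomogeneous n := fun n p hp => by
    rw [hVsum]
    refine IsHomogeneous.sum _ _ _ fun s hs => ?_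
    rw [smul_eq_C_mul]
    exact hdeg hp s hs ▸ (hf s).C_mul _
  have hWV : ∀ (n : ℕ) (p : MvPolynomial (Fin 3) F), p.IsHomogeneous n →
      dunklTaylor κ n (V p) = p := fun n p hp => by
    rw [hVsum, map_sum]
    conv_rhs => rw [p.as_sum]
    refine Finset.sum_congr rfl fun s hs => ?_
    rw [map_smul, ← hdeg hp s hs, hWf, smul_monomial, smul_eq_mul, mul_one]
  have hone : V 1 = 1 := by
    obtain ⟨c, hc⟩ := exists_eq_C_of_isHomogeneous (hVhom 0 1 (isHomogeneous_one _ _))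
    have h := hWV 0 1 (isHomogeneous_one _ _)
    rw [hc, dunklTaylor_zero_apply, constantCoeff_C] at h
    rw [hc, h]
  have hhom : ∀ (i : Fin 3) (n : ℕ) (p : MvPolynomial (Fin 3) F), p.IsHomogeneous n →
      dunkl κ i (V p) = V (pderiv i p) := fun i n p hp => by
    cases n with
    | zero =>
      obtain ⟨c, rfl⟩ := exists_eq_C_of_isHomogeneous hp
      rw [pderiv_C, map_zero, C_eq_smul_one, map_smul, hone, ← C_eq_smul_one, ← dunklDir_single,
        dunklDir_C]
    | succ n =>
      have hp' : (pderiv i p).IsHomogeneous n := hp.pderiv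
      -- Both `W_n 𝓓_i V p` and `W_n V ∂_i p` equal `∂_i p`; injectivity of `W_n` concludes.
      have h : dunklTaylor κ n (dunkl κ i (V p) - V (pderiv i p)) = 0 := by
        rw [map_sub, ← pderiv_dunklTaylor, hWV _ _ hp, hWV _ _ hp', sub_self]
      exact sub_eq_zero.1 (dunklTaylor_eq_zero hκ
        ((isHomogeneous_dunkl κ i (hVhom _ _ hp)).sub (hVhom _ _ hp')) h)
  have hint : ∀ (i : Fin 3) (p : MvPolynomial (Fin 3) F),
      dunkl κ i (V p) = V (pderiv i p) := fun i p => by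
    have h := linearMap_ext_of_isHomogeneous (f := dunklLin κ (Pi.single i 1) ∘ₗ V)
      (g := V ∘ₗ ((pderiv i : Derivation F _ _) : _ →ₗ[F] _)) fun n p hp =>
        (dunklDir_single κ i (V p)).trans (hhom i n p hp)
    exact (dunklDir_single κ i (V p)).symm.trans (LinearMap.congr_fun h p)
  refine ⟨V, fun u p => ?_, hone, hVhom⟩
  rw [dunklDir, derivDir, map_sum]
  refine Finset.sum_congr rfl fun i _ => ?_
  rw [hint, ← smul_eq_C_mul, ← smul_eq_C_mul, map_smul]

end

/-! ### Absence of singular polynomials, and nonvanishing of `ν`. -/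

section

theorem aeval_intertwine {R M N : Type*} [CommRing R] [AddCommGroup M] [AddCommGroup N]
    [Module R M] [Module R N] (T : Module.End R M) (S : Module.End R N) (f : M →ₗ[R] N)
    (h : ∀ x, f (T x) = S (f x)) (m : Polynomial R) (x : M) :
    f (Polynomial.aeval T m x) = Polynomial.aeval S m (f x) := by
  induction m using Polynomial.induction_on' with
  | add p g hp hg => simp only [map_add, LinearMap.add_apply, hp, hg]
  | monomial n a =>
    have hn : f ((T ^ n) x) = (S ^ n) (f x) := by
      induction n with
      | zero => rfl
      | succ n ih => rw [pow_succ', pow_succ', Module.End.mul_apply, h, ih, Module.End.mul_apply]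
    simp [Polynomial.aeval_monomial, hn]

variable {F : Type*} [Field F] [Algebra ℝ F]

variable (F) in
/-- The operator `∑_v (1 - σ_v)`. -/
def reflSum : MvPolynomial (Fin 3) F →ₗ[F] MvPolynomial (Fin 3) F :=
  ∑ k, (LinearMap.id - (reflect F (posRoot k)).toLinearMap)

theorem reflSum_apply (p : MvPolynomial (Fin 3) F) :
    reflSum F p = ∑ k, (p - reflect F (posRoot k) p) := by
  simp [reflSum]

/-- The factor `⟨x, v⟩ = ∑ x_i v_i` cancels the denominators of the difference part. -/
theorem sum_X_mul_dunkl (κ : F) {n : ℕ} {p : MvPolynomial (Fin 3) F} (hp : p.IsHomogeneous n) :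
    ∑ i, X i * dunkl κ i p = C (n : F) * p + C κ * reflSum F p := by
  have h := hp.sum_X_mul_pderiv
  rw [nsmul_eq_mul, ← map_natCast (C : F →+* MvPolynomial (Fin 3) F)] at h
  simp only [dunkl, mul_add, Finset.sum_add_distrib, h, reflSum_apply]
  congr 1
  simp only [Finset.mul_sum]
  rw [Finset.sum_comm]
  refine Finset.sum_congr rfl fun k _ => ?_
  rw [← linForm_mul_divDiff, linForm, Finset.sum_mul, Finset.mul_sum]
  refine Finset.sum_congr rfl fun i _ => ?_
  rw [C_mul]; ring

theorem isHomogeneous_reflSum {n : ℕ} {p : MvPolynomial (Fin 3) F} (hp : p.IsHomogeneous n) :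
    (reflSum F p).IsHomogeneous n := by
  rw [reflSum_apply]
  exact IsHomogeneous.sum _ _ _ fun k _ => hp.sub (isHomogeneous_reflect _ hp)

theorem reflect_map (v : Fin 3 → ℝ) (p : MvPolynomial (Fin 3) ℝ) :
    reflect F v (map (algebraMap ℝ F) p) = map (algebraMap ℝ F) (reflect ℝ v p) := by
  induction p using MvPolynomial.induction_on with
  | C a => simp
  | add p g hp hg => simp only [map_add, hp, hg]
  | mul_X p i hp => simp [hp, reflect_X, linForm]

theorem reflSum_map (p : MvPolynomial (Fin 3) ℝ) :
    reflSum F (map (algebraMap ℝ F) p) = map (algebraMap ℝ F) (reflSum ℝ p) := by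
  simp [reflSum_apply, reflect_map]

/-- `reflSum` is defined over `ℝ` and preserves each finite-dimensional space of forms, so its
eigenvalues are roots of a real minimal polynomial. -/
theorem isAlgebraic_of_reflSum_eq {n : ℕ} {p : MvPolynomial (Fin 3) F} (hp : p.IsHomogeneous n)
    (hp0 : p ≠ 0) {c : F} (h : reflSum F p = c • p) : IsAlgebraic ℝ c := by
  let T : Module.End ℝ (homogeneousSubmodule (Fin 3) ℝ n) :=
    (reflSum ℝ).restrict fun p hp => isHomogeneous_reflSum hp
  have : FiniteDimensional ℝ (homogeneousSubmodule (Fin 3) ℝ n) :=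
    Module.Finite.iff_fg.2 (homogeneousSubmodule_fg _ _ n)
  have hT : IsIntegral ℝ T := Algebra.IsIntegral.isIntegral T
  let S : Module.End ℝ (MvPolynomial (Fin 3) F) := (reflSum F).restrictScalars ℝ
  have hzero : Polynomial.aeval S (minpoly ℝ T) p = 0 := by
    rw [p.as_sum, map_sum]
    refine Finset.sum_eq_zero fun s hs => ?_
    have hs' : s.degree = n := by
      by_contra hne
      exact mem_support_iff.1 hs (hp.coeff_eq_zero hne)
    -- Scaling a real form by the coefficient of `s` in `p` intertwines the real and the extended
    -- operator, so the minimal polynomial of `T` kills each term of `p`.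
    let f : homogeneousSubmodule (Fin 3) ℝ n →ₗ[ℝ] MvPolynomial (Fin 3) F :=
      { toFun := fun g => p.coeff s • map (algebraMap ℝ F) (g : MvPolynomial (Fin 3) ℝ)
        map_add' := by simp
        map_smul' := fun a g => by
          simp only [Submodule.coe_smul, map_mul, map_C, RingHom.id_apply,
            Algebra.smul_def, MvPolynomial.algebraMap_eq, MvPolynomial.algebraMap_apply]
          ring }
    have hf := aeval_intertwine T S f (fun g => by
      change p.coeff s • map (algebraMap ℝ F) (reflSum ℝ (g : MvPolynomial (Fin 3) ℝ)) =
        reflSum F (p.coeff s • map (algebraMap ℝ F) (g : MvPolynomial (Fin 3) ℝ))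
      rw [map_smul, reflSum_map]) (minpoly ℝ T) ⟨monomial s 1, isHomogeneous_monomial 1 hs'⟩
    have hT0 : f (Polynomial.aeval T (minpoly ℝ T)
        ⟨monomial s 1, isHomogeneous_monomial 1 hs'⟩) = 0 :=
      (congrArg (fun A : Module.End ℝ (homogeneousSubmodule (Fin 3) ℝ n) =>
        f (A ⟨monomial s 1, isHomogeneous_monomial 1 hs'⟩)) (minpoly.aeval ℝ T)).trans
        (map_zero f)
    have hfs : f ⟨monomial s 1, isHomogeneous_monomial 1 hs'⟩ = monomial s (p.coeff s) := by
      change p.coeff s • map (algebraMap ℝ F) (monomial s 1) = _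
      rw [map_monomial, map_one, smul_monomial, smul_eq_mul, mul_one]
    rw [← hfs, ← hf, hT0]
  -- On the line `F p` the operator is multiplication by `c`, so the polynomial in `S` applied to
  -- `p` is its value at `c` times `p`.
  let f : F →ₗ[ℝ] MvPolynomial (Fin 3) F := (LinearMap.toSpanSingleton F _ p).restrictScalars ℝ
  have hf := aeval_intertwine (Algebra.lmul ℝ F c) S f (fun a => by
    change (c * a) • p = reflSum F (a • p)
    rw [map_smul, h, smul_smul, mul_comm]) (minpoly ℝ T) 1
  have h1 : f 1 = p := one_smul F p
  rw [h1, hzero, Polynomial.aeval_algHom_apply] at hf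
  have h2 : (Polynomial.aeval c (minpoly ℝ T) * 1) • p = 0 := hf
  rw [mul_one, smul_eq_zero, or_iff_left hp0] at h2
  exact ⟨minpoly ℝ T, (minpoly.monic hT).ne_zero, h2⟩

theorem eq_zero_of_dunkl_eq_zero_of_transcendental {κ : F} (hκ : Transcendental ℝ κ) (n : ℕ)
    (p : MvPolynomial (Fin 3) F) (hp : p.IsHomogeneous (n + 1)) (h : ∀ i, dunkl κ i p = 0) :
    p = 0 := by
  have := charZero_of_algebra_real F
  by_contra hp0
  have hκ0 : κ ≠ 0 := by
    rintro rfl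
    exact hκ isAlgebraic_zero
  have he := sum_X_mul_dunkl κ hp
  simp only [h, mul_zero, Finset.sum_const_zero] at he
  have hc : reflSum F p = (-((n + 1 : ℕ) : F) * κ⁻¹) • p := by
    have h1 : (C κ⁻¹ * C κ : MvPolynomial (Fin 3) F) = 1 := by
      rw [← C_mul, inv_mul_cancel₀ hκ0, C_1]
    rw [smul_eq_C_mul, C_mul, C_neg]
    linear_combination (-C κ⁻¹) * he - reflSum F p * h1
  have ha := isAlgebraic_of_reflSum_eq hp hp0 hc
  have hn : (-((n + 1 : ℕ) : F)) ≠ 0 := neg_ne_zero.2 (Nat.cast_ne_zero.2 n.succ_ne_zero)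
  have hn' : IsAlgebraic ℝ (-((n + 1 : ℕ) : F))⁻¹ := (isAlgebraic_natCast _).neg.inv
  have hk := (hn'.mul ha).inv
  rw [inv_mul_cancel_left₀ hn, inv_inv] at hk
  exact hκ hk

theorem eval_reflect (v x : Fin 3 → ℝ) (p : MvPolynomial (Fin 3) F) :
    eval (fun i => algebraMap ℝ F (x i)) (reflect F v p) =
      eval (fun i => algebraMap ℝ F (vecReflect v x i)) p := by
  induction p using MvPolynomial.induction_on with
  | C a => simp
  | add p g hp hg => simp only [map_add, hp, hg]
  | mul_X p i hp =>
    rw [map_mul, map_mul, hp, map_mul, reflect_X]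
    congr 1
    simp only [linForm, map_sub, map_mul, map_sum, eval_X, eval_C, vecReflect]
    simp only [← map_mul, ← map_sum, ← map_sub]
    congr 1
    simp only [Fin.sum_univ_three]
    ring

/-- `F` carries no topology; real functionals on `F` reduce the maximum principle to real-valued
functions. -/
theorem continuous_dual_eval (φ : F →ₗ[ℝ] ℝ) (p : MvPolynomial (Fin 3) F) :
    Continuous fun x : Fin 3 → ℝ => φ (eval (fun i => algebraMap ℝ F (x i)) p) := by
  have h : ∀ x : Fin 3 → ℝ, φ (eval (fun i => algebraMap ℝ F (x i)) p) =
      ∑ s ∈ p.support, (∏ i, x i ^ s i) * φ (p.coeff s) := fun x => by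
    rw [eval_eq', map_sum]
    refine Finset.sum_congr rfl fun s _ => ?_
    rw [← smul_eq_mul (a := ∏ i, x i ^ s i), ← map_smul, Algebra.smul_def, mul_comm]
    simp
  simp only [h]
  fun_prop

theorem isCompact_sum_sq_le (r : ℝ) : IsCompact {x : Fin 3 → ℝ | ∑ i, x i ^ 2 ≤ r} := by
  refine Metric.isCompact_of_isClosed_isBounded
    (isClosed_le (by fun_prop) continuous_const) ?_
  refine (Metric.isBounded_closedBall (x := (0 : Fin 3 → ℝ)) (r := |r| + 1)).subset fun x hx => ?_
  rw [mem_closedBall_zero_iff, pi_norm_le_iff_of_nonneg (by positivity)]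
  intro i
  have h1 : x i ^ 2 ≤ r :=
    (Finset.single_le_sum (f := fun i => x i ^ 2) (fun i _ => sq_nonneg _)
      (Finset.mem_univ i)).trans hx
  rw [Real.norm_eq_abs]
  exact abs_le_of_sq_le_sq (by nlinarith [le_abs_self r, abs_nonneg r]) (by positivity)

/-- Maximum principle: at a point `y` maximizing `|g|` on a Euclidean ball, which all reflections
preserve, `(n + 15t)|g y| ≤ 15t |g y|`, so `g y = 0` because `n > 0`. -/
theorem eq_zero_of_reflection_sum {g : (Fin 3 → ℝ) → ℝ} (hg : Continuous g) {n t : ℝ}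
    (hn : 0 < n) (ht : 0 ≤ t)
    (h : ∀ x, n * g x + t * ∑ k, (g x - g (vecReflect (posRoot k) x)) = 0) (x : Fin 3 → ℝ) :
    g x = 0 := by
  obtain ⟨y, hy, hmax⟩ := (isCompact_sum_sq_le (∑ i, x i ^ 2)).exists_isMaxOn
    ⟨x, le_refl (∑ i, x i ^ 2)⟩ (hg.abs.continuousOn)
  have hle : ∀ k, |g (vecReflect (posRoot k) y)| ≤ |g y| := fun k => hmax (by
    have hs := sum_vecReflect_mul (posRoot_ne_zero k) y y
    simp only [← pow_two] at hs
    exact hs.trans_le hy)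
  have hsum : |∑ k, g (vecReflect (posRoot k) y)| ≤ 15 * |g y| := by
    refine (Finset.abs_sum_le_sum_abs _ _).trans
      ((Finset.sum_le_sum fun k _ => hle k).trans_eq (by simp))
  have hy0 := h y
  rw [Finset.sum_sub_distrib, Finset.sum_const, Finset.card_univ, Fintype.card_fin,
    nsmul_eq_mul] at hy0
  have heq : (n + 15 * t) * g y = t * ∑ k, g (vecReflect (posRoot k) y) := by
    push_cast at hy0
    linarith
  have habs := congrArg abs heq
  rw [abs_mul, abs_mul, abs_of_nonneg ht, abs_of_nonneg (by positivity)] at habs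
  have h0 : |g y| ≤ 0 := by nlinarith [mul_le_mul_of_nonneg_left hsum ht]
  have hx : |g x| ≤ |g y| := hmax (le_refl (∑ i, x i ^ 2))
  exact abs_nonpos_iff.1 (hx.trans h0)

theorem eq_zero_of_dunkl_eq_zero_of_nonneg {t : ℝ} (ht : 0 ≤ t) (n : ℕ)
    (p : MvPolynomial (Fin 3) F) (hp : p.IsHomogeneous (n + 1))
    (h : ∀ i, dunkl (algebraMap ℝ F t) i p = 0) : p = 0 := by
  have he := sum_X_mul_dunkl (algebraMap ℝ F t) hp
  simp only [h, mul_zero, Finset.sum_const_zero] at he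
  have hev : ∀ x : Fin 3 → ℝ, eval (fun i => algebraMap ℝ F (x i)) p = 0 := fun x => by
    rw [← Module.forall_dual_apply_eq_zero_iff ℝ]
    intro φ
    refine eq_zero_of_reflection_sum (continuous_dual_eval φ p)
      (n := (n + 1 : ℕ)) (by positivity) ht (fun y => ?_) x
    have hy := congrArg (fun q => φ (eval (fun i => algebraMap ℝ F (y i)) q)) he
    simp only [map_zero, map_add, map_mul, eval_C, reflSum_apply, map_sum, map_sub,
      eval_reflect] at hy
    rw [← map_natCast (algebraMap ℝ F), ← Algebra.smul_def, ← Algebra.smul_def, map_smul,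
      map_smul, map_sum] at hy
    simpa only [map_sub, smul_eq_mul] using hy.symm
  -- Vanishing at all real points suffices, as the image of `ℝ` in `F` is infinite.
  refine MvPolynomial.funext_set (fun _ => Set.range (algebraMap ℝ F))
    (fun _ => Set.infinite_range_of_injective (algebraMap ℝ F).injective) fun x hx => ?_
  choose y hy using fun i => hx i (Set.mem_univ i)
  rw [map_zero, ← hev y]
  simp only [hy]

theorem existsUnique_isIntertwining {κ : F}
    (hκ : (∃ t : ℝ, 0 ≤ t ∧ κ = algebraMap ℝ F t) ∨ Transcendental ℝ κ) :
    ∃! V : MvPolynomial (Fin 3) F →ₗ[F] MvPolynomial (Fin 3) F, IsIntertwining κ V := by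
  obtain ⟨V, hV⟩ := exists_isIntertwining (κ := κ) (by
    obtain ⟨t, ht, rfl⟩ | hκ := hκ
    · exact eq_zero_of_dunkl_eq_zero_of_nonneg ht
    · exact eq_zero_of_dunkl_eq_zero_of_transcendental hκ)
  exact ⟨V, hV, fun V' hV' => hV'.unique hV⟩

theorem ascPochhammer_eval_ne_zero {R : Type*} [CommRing R] [IsDomain R] {c : R} :
    ∀ n : ℕ, (∀ k : ℕ, c + k ≠ 0) → (ascPochhammer R n).eval c ≠ 0
  | 0, _ => by simp
  | n + 1, h => by
    rw [ascPochhammer_succ_eval]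
    exact mul_ne_zero (ascPochhammer_eval_ne_zero n h) (h n)

/-- Apart from powers of 2, each factor of `ν(n)` has the form `aκ + b` with `a, b` positive reals.
-/
theorem nu_ne_zero {κ : F}
    (hκ : (∃ t : ℝ, 0 ≤ t ∧ κ = algebraMap ℝ F t) ∨ Transcendental ℝ κ) (n : ℕ) :
    nu κ n ≠ 0 := by
  have := charZero_of_algebra_real F
  have h : ∀ a b : ℝ, 0 < a → 0 < b → algebraMap ℝ F a * κ + algebraMap ℝ F b ≠ 0 := by
    intro a b ha hb h0
    obtain ⟨t, ht, rfl⟩ | hκ := hκ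
    · rw [← map_mul, ← map_add, map_eq_zero] at h0
      nlinarith [mul_nonneg ha.le ht]
    · apply hκ
      have hκ' : κ = algebraMap ℝ F (-b / a) := by
        have ha' : algebraMap ℝ F a ≠ 0 := by simpa using ha.ne'
        rw [map_div₀, map_neg]
        field_simp
        linear_combination h0
      exact hκ' ▸ isAlgebraic_algebraMap _
  refine mul_ne_zero (mul_ne_zero (pow_ne_zero _ two_ne_zero)
    (ascPochhammer_eval_ne_zero _ fun k => ?_)) (ascPochhammer_eval_ne_zero _ fun k => ?_)
  · have hk := h 6 (1 + k) (by norm_num) (by positivity)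
    simpa [add_assoc, map_ofNat (algebraMap ℝ F) 6] using hk
  · have hk := h 5 (1 / 2 + k) (by norm_num) (by positivity)
    simpa [add_assoc, map_ofNat (algebraMap ℝ F) 5, map_ofNat (algebraMap ℝ F) 2] using hk

end

/-! ### The generating function and the action of the Dunkl operators on it. -/

section

/-- Logarithmic differentiation of a product, without division. -/
theorem derivation_prod {R A ι : Type*} [CommRing R] [CommRing A] [Algebra R A]
    (d : Derivation R A A) (s : Finset ι) (f g : ι → A) (h : ∀ j, d (f j) = g j * f j) :
    d (∏ j ∈ s, f j) = (∑ j ∈ s, g j) * ∏ j ∈ s, f j := by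
  classical
  induction s using Finset.induction_on with
  | empty => simp
  | insert j s hj ih =>
    rw [Finset.prod_insert hj, Finset.sum_insert hj, Derivation.leibniz, ih, h, smul_eq_mul,
      smul_eq_mul]
    ring

theorem isHomogeneous_coeff_mul {R σ : Type*} [CommSemiring R]
    {f g : PowerSeries (MvPolynomial σ R)}
    (hf : ∀ n, (PowerSeries.coeff n f).IsHomogeneous n)
    (hg : ∀ n, (PowerSeries.coeff n g).IsHomogeneous n) (n : ℕ) :
    (PowerSeries.coeff n (f * g)).IsHomogeneous n := by
  rw [PowerSeries.coeff_mul]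
  refine IsHomogeneous.sum _ _ _ fun x hx => ?_
  rw [← Finset.HasAntidiagonal.mem_antidiagonal.1 hx]
  exact (hf _).mul (hg _)

theorem isHomogeneous_coeff_prod {R σ ι : Type*} [CommSemiring R] (s : Finset ι)
    {f : ι → PowerSeries (MvPolynomial σ R)}
    (hf : ∀ j n, (PowerSeries.coeff n (f j)).IsHomogeneous n) (n : ℕ) :
    (PowerSeries.coeff n (∏ j ∈ s, f j)).IsHomogeneous n := by
  classical
  induction s using Finset.induction_on generalizing n with
  | empty =>
    rw [Finset.prod_empty, PowerSeries.coeff_one]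
    split_ifs with h
    · exact h ▸ isHomogeneous_one _ _
    · exact isHomogeneous_zero _ _ _
  | insert j s hj ih =>
    rw [Finset.prod_insert hj]
    exact isHomogeneous_coeff_mul (hf j) ih n

/-- The coefficientwise partial derivative of a power series with polynomial coefficients. -/
def pderivSeries {R σ : Type*} [CommRing R] (i : σ) : Derivation R
    (PowerSeries (MvPolynomial σ R)) (PowerSeries (MvPolynomial σ R)) where
  toFun f := PowerSeries.mk fun n => pderiv i (PowerSeries.coeff n f)
  map_add' f g := by ext1 n; simp
  map_smul' c f := by ext1 n; simp
  map_one_eq_zero' := by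
    ext1 n
    simp only [LinearMap.coe_mk, AddHom.coe_mk, PowerSeries.coeff_mk, PowerSeries.coeff_one]
    split_ifs <;> simp
  leibniz' f g := by
    ext1 n
    simp only [LinearMap.coe_mk, AddHom.coe_mk, PowerSeries.coeff_mk, PowerSeries.coeff_mul,
      map_add, map_sum, Derivation.leibniz, smul_eq_mul, Finset.sum_add_distrib]
    congr 1
    rw [← Finset.Nat.sum_antidiagonal_swap]
    rfl

theorem coeff_pderivSeries {R σ : Type*} [CommRing R] (i : σ) (n : ℕ)
    (f : PowerSeries (MvPolynomial σ R)) :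
    PowerSeries.coeff n (pderivSeries i f) = pderiv i (PowerSeries.coeff n f) :=
  PowerSeries.coeff_mk n fun n => pderiv i (PowerSeries.coeff n f)

theorem coeff_negPowSeries {F : Type*} [Field F] (a : MvPolynomial (Fin 3) F) (c : F) (n : ℕ) :
    PowerSeries.coeff n (negPowSeries a c) =
      C ((ascPochhammer F n).eval c / (n.factorial : F)) * a ^ n :=
  PowerSeries.coeff_mk _ _

theorem map_negPowSeries {F : Type*} [Field F]
    (φ : MvPolynomial (Fin 3) F →ₐ[F] MvPolynomial (Fin 3) F)
    (a : MvPolynomial (Fin 3) F) (c : F) :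
    PowerSeries.map (φ : MvPolynomial (Fin 3) F →+* MvPolynomial (Fin 3) F) (negPowSeries a c) =
      negPowSeries (φ a) c := by
  ext1 n
  rw [PowerSeries.coeff_map, coeff_negPowSeries, coeff_negPowSeries]
  simp [algHom_C]

theorem rescale_negPowSeries {F : Type*} [Field F] (a : MvPolynomial (Fin 3) F) (c : F) :
    PowerSeries.rescale (-1) (negPowSeries a c) = negPowSeries (-a) c := by
  ext1 n
  rw [PowerSeries.coeff_rescale, coeff_negPowSeries, coeff_negPowSeries, neg_pow a]
  ring

variable {F : Type*} [Field F] [Algebra ℝ F]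

theorem coeff_negPowSeries_one (a : MvPolynomial (Fin 3) F) (n : ℕ) :
    PowerSeries.coeff n (negPowSeries a 1) = a ^ n := by
  have := charZero_of_algebra_real F
  rw [coeff_negPowSeries, ascPochhammer_eval_one, div_self (Nat.cast_ne_zero.2 n.factorial_ne_zero),
    C_1, one_mul]

theorem one_sub_mul_negPowSeries_one (a : MvPolynomial (Fin 3) F) :
    (1 - PowerSeries.X * PowerSeries.C a) * negPowSeries a 1 = 1 := by
  ext1 n
  rw [sub_mul, one_mul, mul_assoc, map_sub, coeff_negPowSeries_one]
  cases n with
  | zero => simp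
  | succ n =>
    rw [PowerSeries.coeff_succ_X_mul, PowerSeries.coeff_C_mul, coeff_negPowSeries_one,
      PowerSeries.coeff_one, pow_succ', sub_self, if_neg n.succ_ne_zero]

/-- This is `c (1 - ra)^(-c-1)`, the common core of the derivatives of `(1 - ra)^(-c)` in `r` and in
`x_i`. -/
theorem mk_eq_mul_negPowSeries (a : MvPolynomial (Fin 3) F) (c : F) :
    PowerSeries.mk (fun n => C ((ascPochhammer F (n + 1)).eval c / (n.factorial : F)) * a ^ n) =
      PowerSeries.C (C c) * negPowSeries a 1 * negPowSeries a c := by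
  have := charZero_of_algebra_real F
  have h : (1 - PowerSeries.X * PowerSeries.C a) *
      PowerSeries.mk (fun n => C ((ascPochhammer F (n + 1)).eval c / (n.factorial : F)) * a ^ n) =
      PowerSeries.C (C c) * negPowSeries a c := by
    ext1 n
    rw [sub_mul, one_mul, mul_assoc, map_sub, PowerSeries.coeff_mk, PowerSeries.coeff_C_mul,
      coeff_negPowSeries]
    cases n with
    | zero => simp
    | succ n =>
      have hn : (n + 1 : F) ≠ 0 := by exact_mod_cast n.succ_ne_zero
      have hf : (n.factorial : F) ≠ 0 := Nat.cast_ne_zero.2 n.factorial_ne_zero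
      rw [PowerSeries.coeff_succ_X_mul, PowerSeries.coeff_C_mul, PowerSeries.coeff_mk,
        mul_left_comm, ← pow_succ', ← sub_mul, ← C_sub, ← mul_assoc, ← C_mul,
        ascPochhammer_succ_eval (n + 1), Nat.factorial_succ]
      congr 2
      push_cast
      field_simp
      ring
  rw [mul_right_comm, ← h]
  linear_combination (-PowerSeries.mk (fun n =>
    C ((ascPochhammer F (n + 1)).eval c / (n.factorial : F)) * a ^ n)) *
      one_sub_mul_negPowSeries_one a

theorem derivative_negPowSeries (a : MvPolynomial (Fin 3) F) (c : F) :
    PowerSeries.derivative (MvPolynomial (Fin 3) F) (negPowSeries a c) =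
      PowerSeries.C a * PowerSeries.C (C c) * negPowSeries a 1 * negPowSeries a c := by
  have := charZero_of_algebra_real F
  rw [mul_assoc, mul_assoc, ← mul_assoc (PowerSeries.C (C c)), ← mk_eq_mul_negPowSeries]
  ext1 n
  rw [PowerSeries.coeff_derivative, coeff_negPowSeries, PowerSeries.coeff_C_mul,
    PowerSeries.coeff_mk]
  have hn : (n + 1 : F) ≠ 0 := by exact_mod_cast n.succ_ne_zero
  have h1 : ((n : MvPolynomial (Fin 3) F) + 1) = C (n + 1 : F) := by simp
  have h2 : (ascPochhammer F (n + 1)).eval c / ((n + 1).factorial : F) * (n + 1) =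
      (ascPochhammer F (n + 1)).eval c / (n.factorial : F) := by
    rw [Nat.factorial_succ]
    push_cast
    field_simp
  rw [h1, ← h2, C_mul]
  ring

theorem pderivSeries_negPowSeries (i : Fin 3) (a : MvPolynomial (Fin 3) F) (c : F) :
    pderivSeries i (negPowSeries a c) = PowerSeries.X * PowerSeries.C (pderiv i a) *
      PowerSeries.C (C c) * negPowSeries a 1 * negPowSeries a c := by
  have := charZero_of_algebra_real F
  rw [mul_assoc, mul_assoc, ← mul_assoc (PowerSeries.C (C c)), ← mk_eq_mul_negPowSeries, mul_assoc]
  ext1 n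
  rw [coeff_pderivSeries, coeff_negPowSeries, pderiv_C_mul, Derivation.leibniz_pow]
  cases n with
  | zero => simp
  | succ n =>
    rw [PowerSeries.coeff_succ_X_mul, PowerSeries.coeff_C_mul, PowerSeries.coeff_mk]
    have hn : (n + 1 : F) ≠ 0 := by exact_mod_cast n.succ_ne_zero
    have h2 : (ascPochhammer F (n + 1)).eval c / ((n + 1).factorial : F) * ((n + 1 : ℕ) : F) =
        (ascPochhammer F (n + 1)).eval c / (n.factorial : F) := by
      rw [Nat.factorial_succ]
      push_cast
      field_simp
    rw [← h2, C_mul, nsmul_eq_mul, smul_eq_mul, map_natCast, Nat.add_sub_cancel]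
    ring

/-- The power series `(1 - r ⟨x, y⟩)⁻¹` for the `j`-th vertex `y`. -/
def vertexInv (F : Type*) [Field F] [Algebra ℝ F] (j : Fin 12) :
    PowerSeries (MvPolynomial (Fin 3) F) :=
  negPowSeries (linForm F (icosVertex j)) 1

/-- The power series `∏_{y ∈ 𝓘} (1 - r ⟨x, y⟩)^(-κ)`. -/
def vertexProd (κ : F) : PowerSeries (MvPolynomial (Fin 3) F) :=
  ∏ j, negPowSeries (linForm F (icosVertex j)) κ

theorem genFun_icosVertex (κ : F) (j : Fin 12) :
    genFun κ (icosVertex j) = vertexInv F j * vertexProd κ := rfl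

theorem one_sub_mul_vertexInv (j : Fin 12) :
    (1 - PowerSeries.X * PowerSeries.C (linForm F (icosVertex j))) * vertexInv F j = 1 :=
  one_sub_mul_negPowSeries_one _

/-- The full product is invariant because reflections permute the vertices; only the distinguished
factor moves. -/
theorem map_reflect_genFun (κ : F) (k : Fin 15) (j : Fin 12) :
    PowerSeries.map (reflect F (posRoot k) : MvPolynomial (Fin 3) F →+* MvPolynomial (Fin 3) F)
      (genFun κ (icosVertex j)) = vertexInv F (vertexPerm k j) * vertexProd κ := by
  rw [genFun_icosVertex, map_mul, vertexInv, vertexProd, map_prod]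
  simp only [map_negPowSeries, reflect_linForm, ← icosVertex_vertexPerm]
  rw [vertexInv, (vertexPerm_involutive k).bijective.prod_comp
    fun j => negPowSeries (linForm F (icosVertex j)) κ]

theorem rescale_genFun (κ : F) (j : Fin 12) :
    PowerSeries.rescale (-1) (genFun κ (icosVertex j)) =
      vertexInv F (vertexNeg j) * vertexProd κ := by
  rw [genFun_icosVertex, map_mul, vertexInv, vertexProd, map_prod]
  simp only [rescale_negPowSeries, ← linForm_neg, ← icosVertex_vertexNeg]
  rw [vertexInv, vertexNeg_involutive.bijective.prod_comp
    fun j => negPowSeries (linForm F (icosVertex j)) κ]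

theorem pderivSeries_genFun (κ : F) (i : Fin 3) (j : Fin 12) :
    pderivSeries i (genFun κ (icosVertex j)) = PowerSeries.X * genFun κ (icosVertex j) *
      (PowerSeries.C (C (algebraMap ℝ F (icosVertex j i))) * vertexInv F j +
        PowerSeries.C (C κ) *
          ∑ m, PowerSeries.C (C (algebraMap ℝ F (icosVertex m i))) * vertexInv F m) := by
  have h := derivation_prod (pderivSeries i) Finset.univ
    (fun j => negPowSeries (linForm F (icosVertex j)) κ) _
    fun j => pderivSeries_negPowSeries i (linForm F (icosVertex j)) κ
  have h1 := pderivSeries_negPowSeries i (linForm F (icosVertex j)) 1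
  simp only [pderiv_linForm] at h h1
  have hs : ∑ m, PowerSeries.X * PowerSeries.C (C (algebraMap ℝ F (icosVertex m i))) *
      PowerSeries.C (C κ) * negPowSeries (linForm F (icosVertex m)) 1 =
      PowerSeries.X * (PowerSeries.C (C κ) *
          ∑ m, PowerSeries.C (C (algebraMap ℝ F (icosVertex m i))) * vertexInv F m) := by
    simp only [Finset.mul_sum]
    refine Finset.sum_congr rfl fun m _ => ?_
    rw [vertexInv]; ring
  rw [hs] at h
  rw [genFun_icosVertex, Derivation.leibniz, vertexInv, h1, vertexProd, h, smul_eq_mul,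
    smul_eq_mul, C_1, map_one]
  ring

theorem derivative_X_mul_genFun (κ : F) (j : Fin 12) :
    PowerSeries.derivative (MvPolynomial (Fin 3) F) (PowerSeries.X * genFun κ (icosVertex j)) =
      genFun κ (icosVertex j) *
        (vertexInv F j + PowerSeries.C (C κ) * (∑ m, vertexInv F m - 12)) := by
  have h := derivation_prod (PowerSeries.derivative (MvPolynomial (Fin 3) F)) Finset.univ
    (fun j => negPowSeries (linForm F (icosVertex j)) κ) _
    fun j => derivative_negPowSeries (linForm F (icosVertex j)) κ
  have h1 := derivative_negPowSeries (linForm F (icosVertex j)) 1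
  have hs : PowerSeries.X * ∑ m, PowerSeries.C (linForm F (icosVertex m)) *
      PowerSeries.C (C κ) * negPowSeries (linForm F (icosVertex m)) 1 =
      PowerSeries.C (C κ) * (∑ m, vertexInv F m - 12) := by
    have h12 : (12 : PowerSeries (MvPolynomial (Fin 3) F)) = ∑ _m : Fin 12, 1 := by simp
    rw [h12, ← Finset.sum_sub_distrib, Finset.mul_sum, Finset.mul_sum]
    refine Finset.sum_congr rfl fun m _ => ?_
    have hm := one_sub_mul_vertexInv (F := F) m
    rw [vertexInv] at hm ⊢
    linear_combination (-PowerSeries.C (C κ)) * hm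
  have hj := one_sub_mul_vertexInv (F := F) j
  rw [Derivation.leibniz, PowerSeries.derivative_X, genFun_icosVertex, Derivation.leibniz,
    vertexInv, h1, vertexProd, h, smul_eq_mul, smul_eq_mul, smul_eq_mul, smul_eq_mul, C_1, map_one,
    ← hs]
  rw [vertexInv] at hj
  linear_combination (-negPowSeries (linForm F (icosVertex j)) 1 *
    ∏ j, negPowSeries (linForm F (icosVertex j)) κ) * hj

/-- A difference of two geometric series: `y - y σ_v` is a multiple of `v`, which supplies the
factor `⟨x, v⟩` to cancel. -/
theorem divDiff_coeff_genFun (κ : F) (k : Fin 15) (j : Fin 12) :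
    PowerSeries.mk (fun n => divDiff (posRoot k)
      (PowerSeries.coeff n (genFun κ (icosVertex j)))) =
    PowerSeries.X * genFun κ (icosVertex j) *
      (PowerSeries.C (C (algebraMap ℝ F ((icosVertex j ⬝ᵥ posRoot k) / 2))) *
        vertexInv F (vertexPerm k j)) := by
  have h1 : PowerSeries.C (linForm F (posRoot k)) * PowerSeries.mk (fun n => divDiff (posRoot k)
      (PowerSeries.coeff n (genFun κ (icosVertex j)))) =
      genFun κ (icosVertex j) - vertexInv F (vertexPerm k j) * vertexProd κ := by
    rw [← map_reflect_genFun]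
    ext1 n
    rw [PowerSeries.coeff_C_mul, PowerSeries.coeff_mk, linForm_mul_divDiff, map_sub,
      PowerSeries.coeff_map]
    rfl
  have hne : PowerSeries.C (linForm F (posRoot k)) ≠ 0 := by
    rw [Ne, map_eq_zero_iff _ PowerSeries.C_injective]
    exact linForm_ne_zero (posRoot_ne_zero k)
  have hj := one_sub_mul_vertexInv (F := F) j
  have hk := one_sub_mul_vertexInv (F := F) (vertexPerm k j)
  rw [icosVertex_vertexPerm, vecReflect_posRoot_eq, linForm_sub, linForm_smul, map_sub, map_mul]
    at hk
  refine mul_left_cancel₀ hne ?_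
  rw [h1, genFun_icosVertex]
  linear_combination vertexInv F (vertexPerm k j) * vertexProd κ * hj -
    vertexInv F j * vertexProd κ * hk

/-- The condition `h j = 0` discards the reflections that fix the vertex `j`. -/
theorem sum_vertexPerm {M : Type*} [AddCommGroup M] (h : Fin 12 → M) (j : Fin 12) (hj : h j = 0) :
    ∑ k, h (vertexPerm k j) = ∑ m, h m - h (vertexNeg j) := by
  rw [← Finset.sum_fiberwise Finset.univ (fun k => vertexPerm k j), eq_sub_iff_add_eq,
    ← Finset.add_sum_erase _ _ (Finset.mem_univ (vertexNeg j)),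
    ← Finset.add_sum_erase _ h (Finset.mem_univ (vertexNeg j))]
  have hm : ∀ m, ∑ k with vertexPerm k j = m, h (vertexPerm k j) =
      (Finset.univ.filter fun k => vertexPerm k j = m).card • h m := fun m => by
    rw [← Finset.sum_const]
    exact Finset.sum_congr rfl fun k hk => by rw [(Finset.mem_filter.1 hk).2]
  rw [hm, card_vertexPerm_eq _ _ (vertexNeg_ne j), if_pos rfl, zero_smul, zero_add, add_comm]
  congr 1
  refine Finset.sum_congr rfl fun m hmem => ?_
  rw [hm]
  by_cases hmj : m = j
  · rw [hmj, hj, smul_zero]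
  · rw [card_vertexPerm_eq _ _ hmj, if_neg (Finset.ne_of_mem_erase hmem), one_smul]

/-- The weights `(y - y_m)_i` in the difference part cancel the `y_m` terms of the ordinary
derivative, so `y_i` factors out. The missing antipode contributes `-2κ/(1 + r⟨x, y⟩)`. -/
theorem dunkl_coeff_genFun (κ : F) (i : Fin 3) (j : Fin 12) :
    PowerSeries.mk (fun n => dunkl κ i (PowerSeries.coeff n (genFun κ (icosVertex j)))) =
      PowerSeries.C (C (algebraMap ℝ F (icosVertex j i))) *
        (PowerSeries.X * PowerSeries.derivative (MvPolynomial (Fin 3) F)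
            (PowerSeries.X * genFun κ (icosVertex j)) +
          PowerSeries.C (C κ) * (PowerSeries.X * (11 * genFun κ (icosVertex j) -
            PowerSeries.rescale (-1) (genFun κ (icosVertex j))))) := by
  have h1 : PowerSeries.mk (fun n => dunkl κ i
        (PowerSeries.coeff n (genFun κ (icosVertex j)))) =
      pderivSeries i (genFun κ (icosVertex j)) +
        PowerSeries.C (C κ) * ∑ k, PowerSeries.C (C (algebraMap ℝ F (posRoot k i))) *
          PowerSeries.mk (fun n => divDiff (posRoot k)
            (PowerSeries.coeff n (genFun κ (icosVertex j)))) := by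
    ext1 n
    simp only [PowerSeries.coeff_mk, map_add, coeff_pderivSeries, PowerSeries.coeff_C_mul, map_sum,
      dunkl, Finset.mul_sum, C_mul, mul_assoc]
  have h2 : ∑ k, PowerSeries.C (C (algebraMap ℝ F (posRoot k i))) *
      PowerSeries.mk (fun n => divDiff (posRoot k)
        (PowerSeries.coeff n (genFun κ (icosVertex j)))) =
      PowerSeries.X * genFun κ (icosVertex j) *
        ∑ k, PowerSeries.C (C (algebraMap ℝ F
          (icosVertex j i - icosVertex (vertexPerm k j) i))) * vertexInv F (vertexPerm k j) := by
    rw [Finset.mul_sum]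
    refine Finset.sum_congr rfl fun k _ => ?_
    have hv : icosVertex j i - icosVertex (vertexPerm k j) i =
        (icosVertex j ⬝ᵥ posRoot k) / 2 * posRoot k i := by
      rw [icosVertex_vertexPerm, vecReflect_posRoot, dotProduct]; ring
    rw [divDiff_coeff_genFun, hv, map_mul (algebraMap ℝ F), C_mul, map_mul]
    ring
  have h3 := sum_vertexPerm (fun m => PowerSeries.C (C (algebraMap ℝ F
    (icosVertex j i - icosVertex m i))) * vertexInv F m) j (by simp)
  have h4 : ∑ m, PowerSeries.C (C (algebraMap ℝ F (icosVertex j i - icosVertex m i))) *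
      vertexInv F m = PowerSeries.C (C (algebraMap ℝ F (icosVertex j i))) * ∑ m, vertexInv F m -
        ∑ m, PowerSeries.C (C (algebraMap ℝ F (icosVertex m i))) * vertexInv F m := by
    simp only [map_sub, sub_mul, Finset.sum_sub_distrib, Finset.mul_sum]
  have hj := one_sub_mul_vertexInv (F := F) j
  have hn := one_sub_mul_vertexInv (F := F) (vertexNeg j)
  rw [icosVertex_vertexNeg, linForm_neg, map_neg] at hn
  have h5 : (PowerSeries.C (C (algebraMap ℝ F
      (icosVertex j i - icosVertex (vertexNeg j) i))) : PowerSeries (MvPolynomial (Fin 3) F)) =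
      2 * PowerSeries.C (C (algebraMap ℝ F (icosVertex j i))) := by
    rw [icosVertex_vertexNeg, Pi.neg_apply, sub_neg_eq_add, map_add, map_add, map_add, two_mul]
  simp only [h4, h5] at h3
  rw [h1, h2, h3, pderivSeries_genFun, derivative_X_mul_genFun, rescale_genFun, genFun_icosVertex]
  -- With `u = (1 - r⟨x, y⟩)⁻¹` and `w = (1 + r⟨x, y⟩)⁻¹`, the remaining identity is `2uw = u + w`;
  -- it turns the coefficient 12 into 11 and produces `G(-r)`.
  linear_combination (-PowerSeries.C (C κ)) * PowerSeries.X *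
    PowerSeries.C (C (algebraMap ℝ F (icosVertex j i))) * vertexProd κ *
      (vertexInv F j * hn + vertexInv F (vertexNeg j) * hj)

theorem dunkl_q (κ : F) (i : Fin 3) (j : Fin 12) (n : ℕ) :
    dunkl κ i (q κ (n + 1) (icosVertex j)) =
      C (algebraMap ℝ F (icosVertex j i) * ((n + 1 : F) + κ * (11 - (-1) ^ n))) *
        q κ n (icosVertex j) := by
  have h := congrArg (PowerSeries.coeff (n + 1)) (dunkl_coeff_genFun κ i j)
  have h11 : (11 : PowerSeries (MvPolynomial (Fin 3) F)) = PowerSeries.C (C 11) := by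
    simp only [map_ofNat]
  rw [PowerSeries.coeff_mk, PowerSeries.coeff_C_mul, map_add, PowerSeries.coeff_succ_X_mul,
    PowerSeries.coeff_derivative, PowerSeries.coeff_succ_X_mul, PowerSeries.coeff_C_mul,
    PowerSeries.coeff_succ_X_mul, map_sub, h11, PowerSeries.coeff_C_mul,
    PowerSeries.coeff_rescale] at h
  rw [q, q, h]
  simp only [map_mul, map_add, map_sub, map_pow, map_neg, map_one, map_natCast]
  ring

theorem q_zero (κ : F) (y : Fin 3 → ℝ) : q κ 0 y = 1 := by
  have h : ∀ (a : MvPolynomial (Fin 3) F) (c : F),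
      PowerSeries.constantCoeff (negPowSeries a c) = 1 := fun a c => by
    rw [← PowerSeries.coeff_zero_eq_constantCoeff_apply, coeff_negPowSeries]
    simp
  rw [q, PowerSeries.coeff_zero_eq_constantCoeff_apply, genFun, map_mul, map_prod]
  simp only [h, Finset.prod_const_one, mul_one]

theorem isHomogeneous_coeff_negPowSeries (y : Fin 3 → ℝ) (c : F) (n : ℕ) :
    (PowerSeries.coeff n (negPowSeries (linForm F y) c)).IsHomogeneous n := by
  rw [coeff_negPowSeries]
  have h := ((isHomogeneous_linForm (F := F) y).pow n).C_mul
    ((ascPochhammer F n).eval c / (n.factorial : F))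
  rwa [one_mul] at h

theorem isHomogeneous_q (κ : F) (n : ℕ) (y : Fin 3 → ℝ) : (q κ n y).IsHomogeneous n :=
  isHomogeneous_coeff_mul (isHomogeneous_coeff_negPowSeries y 1)
    (isHomogeneous_coeff_prod _ fun j => isHomogeneous_coeff_negPowSeries (icosVertex j) κ) n

/-- For `n = 2m` the factor is `2(5κ + 1/2 + m)`; for `n = 2m + 1` it is `2(6κ + 1 + m)`. -/
theorem nu_succ (κ : F) (n : ℕ) :
    nu κ (n + 1) = ((n + 1 : F) + κ * (11 - (-1) ^ n)) * nu κ n := by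
  have := charZero_of_algebra_real F
  obtain ⟨m, rfl | rfl⟩ := n.even_or_odd'
  · have h1 : (2 * m + 1) / 2 = m := by omega
    have h2 : (2 * m + 1 + 1) / 2 = m + 1 := by omega
    have h3 : 2 * m / 2 = m := by omega
    rw [nu, nu, h1, h2, h3, ascPochhammer_succ_eval, pow_succ, (even_two_mul m).neg_one_pow]
    push_cast
    field_simp
    ring
  · have h1 : (2 * m + 1) / 2 = m := by omega
    have h2 : (2 * m + 1 + 1) / 2 = m + 1 := by omega
    have h3 : (2 * m + 1 + 1 + 1) / 2 = m + 1 := by omega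
    rw [nu, nu, h1, h2, h3, ascPochhammer_succ_eval m (6 * κ + 1), pow_succ,
      (odd_two_mul_add_one m).neg_one_pow]
    push_cast
    ring

theorem dunklTaylor_q (κ : F) (j : Fin 12) (n : ℕ) :
    dunklTaylor κ n (q κ n (icosVertex j)) =
      C (nu κ n / (n.factorial : F)) * linForm F (icosVertex j) ^ n := by
  have := charZero_of_algebra_real F
  induction n with
  | zero => simp [q_zero, dunklTaylor_zero_apply, nu]
  | succ n ih =>
    have h : ∀ c : F, dunklTaylor κ n (C c * q κ n (icosVertex j)) =
        C c * (C (nu κ n / (n.factorial : F)) * linForm F (icosVertex j) ^ n) := fun c => by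
      rw [← ih, ← smul_eq_C_mul, map_smul, smul_eq_C_mul]
    have hl : ∑ i, X i * C (algebraMap ℝ F (icosVertex j i)) = linForm F (icosVertex j) := by
      simp only [linForm, mul_comm]
    have hc : nu κ (n + 1) / ((n + 1).factorial : F) =
        (n + 1 : F)⁻¹ * (((n + 1 : F) + κ * (11 - (-1) ^ n)) * (nu κ n / (n.factorial : F))) := by
      rw [nu_succ, Nat.factorial_succ]
      push_cast
      rw [div_eq_mul_inv, mul_inv]
      ring
    simp only [dunklTaylor_succ_apply, dunkl_q, h]
    rw [hc, pow_succ', ← hl, Finset.sum_mul, Finset.mul_sum, Finset.mul_sum]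
    refine Finset.sum_congr rfl fun i _ => ?_
    rw [hl]
    simp only [C_mul]
    ring

/-- Both sides have the same image under `W_n`, which is injective in degree `n` because `V` exists.
-/
theorem IsIntertwining.linForm_pow {κ : F}
    {V : MvPolynomial (Fin 3) F →ₗ[F] MvPolynomial (Fin 3) F} (hV : IsIntertwining κ V)
    (j : Fin 12) {n : ℕ} (hn : nu κ n ≠ 0) :
    V (linForm F (icosVertex j) ^ n) =
      ((n.factorial : F) / nu κ n) • q κ n (icosVertex j) := by
  have := charZero_of_algebra_real F
  have hl : (linForm F (icosVertex j) ^ n).IsHomogeneous n := by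
    have h := (isHomogeneous_linForm (F := F) (icosVertex j)).pow n
    rwa [one_mul] at h
  refine hV.dunklTaylor_injOn (hV.homogeneous _ _ hl) ?_ ?_
  · rw [smul_eq_C_mul]
    exact (isHomogeneous_q κ n _).C_mul _
  · have hf : (n.factorial : F) ≠ 0 := Nat.cast_ne_zero.2 n.factorial_ne_zero
    rw [hV.dunklTaylor_apply hl, map_smul, dunklTaylor_q, smul_eq_C_mul, ← mul_assoc, ← C_mul,
      div_mul_div_cancel₀ hn, div_self hf, C_1, one_mul]

end

end DunklH3

end

theorem mainTheorem3 {F : Type*} [Field F] [Algebra ℝ F] (κ : F) :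
    (((∃ t : ℝ, 0 ≤ t ∧ κ = algebraMap ℝ F t) ∨ Transcendental ℝ κ) →
      (∃! V : MvPolynomial (Fin 3) F →ₗ[F] MvPolynomial (Fin 3) F,
        DunklH3.IsIntertwining κ V) ∧
      ∀ n : ℕ, DunklH3.nu κ n ≠ 0) ∧
    ∀ V : MvPolynomial (Fin 3) F →ₗ[F] MvPolynomial (Fin 3) F,
      DunklH3.IsIntertwining κ V →
      ∀ y₀ ∈ DunklH3.icosahedron, ∀ n : ℕ, DunklH3.nu κ n ≠ 0 →
        V (DunklH3.linForm F y₀ ^ n) =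
          ((n.factorial : F) / DunklH3.nu κ n) • DunklH3.q κ n y₀ := by
  refine ⟨fun hκ => ⟨DunklH3.existsUnique_isIntertwining hκ, DunklH3.nu_ne_zero hκ⟩, ?_⟩
  rintro V hV y₀ ⟨j, rfl⟩ n hn
  exact hV.linForm_pow j hn
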